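/- **Theorem (Convergence of DMPower).** There are absolute constants $c, C_1, C_2 > 0$ such that the following holds. Let $d \ge 3$ and let $A \in \mathbb{R}^{d\times d}$ be symmetric positive semidefinite with eigenvalues $1 \ge \lambda_1 > \lambda_2 > \lambda_3 \ge \cdots \ge \lambda_d \ge 0$ and orthonormal eigenvectors $v_1,\dots,v_d$. Let $0<\epsilon<1$, $0 < \rho < \min\{1/2, \sqrt{(\lambda_1-\lambda_2)/(\lambda_2-\lambda_d)}\}$, $\tau > 1$ and $\delta = \min\{\rho, 1/(\tau\sqrt d)\}$. Let $q_0, w_0$ be independent and uniformly distributed on the unit sphere of $\mathbb{R}^d$, and let $\theta_0 = \arccos|q_0^\top v_1|$. *Pre-momentum phase.* For $j = 1,2,\dots$ put $$q_j = \frac{Aq_{j-1}}{\|Aq_{j-1}\|},\qquad \nu_j = q_j^\top A q_j,\qquad w_j = \frac{(A-\nu_j q_jq_j^\top)w_{j-1}}{\|(A-\nu_j q_jq_j^\top)w_{j-1}\|},\qquad \mu_j = w_j^\top A w_j .$$ *Momentum phase (Power+M).* After $J$ such steps set $\beta = \mu_J^2/4$. Start with $p_0 = 0$, $r_0 = q_J$,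 and for $k \ge 0$ put $y = Ar_k-\beta p_k$, $p_{k+1} = r_k/\|y\|$, $r_{k+1} = y/\|y\|$ (so $r_k$ is, up to normalization, the vector $x_k$ of the recurrence $x_{k+1} = Ax_k-\beta x_{k-1}$, $x_0=q_J$, $x_{-1}=0$). The output of DMPower with $J$ pre-momentum and $K$ momentum steps is $r_K$. Then, with probability at least $1-\tau^{-c}-e^{-cd}$ over $(q_0,w_0)$, for every integer $$J \;\ge\; C_1\left(\frac{1}{\lambda_1-\lambda_2}\log\frac{\tan^2\theta_0}{\delta(\lambda_2-\lambda_3)}+\frac{\lambda_2}{\lambda_2-\lambda_3}\log\frac{d\tau}{\rho}\right)$$ one has $|\mu_J-\lambda_2|<\rho$ and $4\beta<\lambda_1^2$, and for every integer $$K \;\ge\; C_2\left(1+\frac{\sqrt{\beta}}{\sqrt{\lambda_1^2-4\beta}}\right)\log\frac1\epsilon$$ the output satisfies $\sin^2\theta(r_K,v_1) = 1-(r_K^\top v_1)^2<\epsilon$. -/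

import Mathlib

open MeasureTheory

noncomputable section

namespace DMPower

/-- `ℝ^d` with the Euclidean norm. -/
abbrev Vec (d : ℕ) : Type := EuclideanSpace ℝ (Fin d)

/-- The matrix-vector product `A x`. -/
def matVec {d : ℕ} (A : Matrix (Fin d) (Fin d) ℝ) (x : Vec d) : Vec d :=
  WithLp.toLp 2 (A.mulVec x.ofLp)

/-- The Rayleigh quotient `xᵀ A x` of a unit vector `x`. -/
def rayleigh {d : ℕ} (A : Matrix (Fin d) (Fin d) ℝ) (x : Vec d) : ℝ :=
  inner ℝ x (matVec A x)

/-- The vector `x / ‖x‖`. -/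
def normalize {d : ℕ} (x : Vec d) : Vec d := ‖x‖⁻¹ • x

/-- Inexact Hotelling deflation applied to `w`: the vector `(A - ν q qᵀ) w` with `ν = qᵀ A q`. -/
def deflate {d : ℕ} (A : Matrix (Fin d) (Fin d) ℝ) (q w : Vec d) : Vec d :=
  matVec A w - (rayleigh A q * inner ℝ q w) • q

/-- The pre-momentum phase: the pair `(q_j, w_j)` after `j` rounds, where
`q_j = A q_{j-1} / ‖A q_{j-1}‖` and `w_j` is `(A - ν_j q_j q_jᵀ) w_{j-1}`, normalized. -/
def preMomentum {d : ℕ} (A : Matrix (Fin d) (Fin d) ℝ) (q₀ w₀ : Vec d) : ℕ → Vec d × Vec d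
  | 0 => (q₀, w₀)
  | j + 1 =>
    let q := normalize (matVec A (preMomentum A q₀ w₀ j).1)
    (q, normalize (deflate A q (preMomentum A q₀ w₀ j).2))

/-- The estimate `μ_j = w_jᵀ A w_j` of the second eigenvalue. -/
def mu {d : ℕ} (A : Matrix (Fin d) (Fin d) ℝ) (q₀ w₀ : Vec d) (j : ℕ) : ℝ :=
  rayleigh A (preMomentum A q₀ w₀ j).2

/-- The momentum coefficient `β = μ_J² / 4` that is set after `J` pre-momentum rounds. -/
def beta {d : ℕ} (A : Matrix (Fin d) (Fin d) ℝ) (q₀ w₀ : Vec d) (J : ℕ) : ℝ :=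
  mu A q₀ w₀ J ^ 2 / 4

/-- The power method with momentum (Power+M), started at `q` with previous iterate `0`.
The state after `k` steps is the pair (previous iterate, current iterate); a step computes
`y = A cur - β prev` and divides the two vectors of the new pair `(cur, y)` by `‖y‖`, so that
up to a common positive factor the pairs follow the linear recurrence
`x_{k+1} = A x_k - β x_{k-1}` and the current iterate is a unit vector. -/
def momentum {d : ℕ} (A : Matrix (Fin d) (Fin d) ℝ) (β : ℝ) (q : Vec d) : ℕ → Vec d × Vec d
  | 0 => (0, q)
  | k + 1 =>
    let y := matVec A (momentum A β q k).2 - β • (momentum A β q k).1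
    (‖y‖⁻¹ • (momentum A β q k).2, ‖y‖⁻¹ • y)

/-- The vector output by DMPower with `J` pre-momentum steps and `K` momentum steps. -/
def output {d : ℕ} (A : Matrix (Fin d) (Fin d) ℝ) (q₀ w₀ : Vec d) (J K : ℕ) : Vec d :=
  (momentum A (beta A q₀ w₀ J) (preMomentum A q₀ w₀ J).1 K).2

/-- `sin² θ(q, v) = 1 - (qᵀ v)²` for unit vectors `q`, `v`. -/
def sinSq {d : ℕ} (q v : Vec d) : ℝ := 1 - (inner ℝ q v) ^ 2

/-- The angle `arccos |qᵀ v|` between the lines spanned by unit vectors `q`, `v`. -/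
def lineAngle {d : ℕ} (q v : Vec d) : ℝ := Real.arccos |inner ℝ q v|

/-- The uniform probability measure on the unit sphere of `ℝ^d` (for `d ≥ 1`). -/
def uniformSphere (d : ℕ) : Measure (Metric.sphere (0 : Vec d) 1) :=
  ((volume : Measure (Vec d)).toSphere Set.univ)⁻¹ • (volume : Measure (Vec d)).toSphere

end DMPower

end

namespace DMPower

/-! In the eigenbasis everything is diagonal, and the theorem splits into a statement about
well-placed starting vectors (`dmpower_of_good_start`) and a bound on the probability of badly
placed ones.

Pre-momentum phase. Since `q_j` is proportional to `A^j q₀`, each deflation subtracts a multiple of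
`A^j q₀`, so `w_j` is proportional to `A^j (w₀ - s_j q₀)` for scalars `s_j` (`shift`,
`preMomentum_snd`). The ideal value `s* = ⟨v₁,w₀⟩ / ⟨v₁,q₀⟩` removes the `v₁` component. The error
`s_j - s*` obeys a linear recurrence with factor at most `tan²θ₀ (λ₂/λ₁)^(2j+1)` and a decaying
source (`abs_shift_sub_le`). The factors may exceed 1 at first, but their product is eventually
tiny, and the error becomes much smaller than `(λ₂/λ₁)^j`: even after amplification by `λ₁^j`, the
`v₁` component is negligible against `λ₂^j`. What remains is the power method on the complement of
`v₁`, so `μ_J` approaches `λ₂`, provided that `w₀ - s* q₀` has a sizeable `v₂` component; that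
component is a 2×2 minor of the coordinates divided by `⟨v₁,q₀⟩` (`rayleigh_shift_bounds`).

Momentum phase. With `m = μ_J` and `β = (m/2)²`, the coordinates are multiplied by rescaled
Chebyshev polynomials of the second kind: at most `(k+1)(m/2)^k` on `[0,m]`, exponentially larger at
`λ₁ = m cosh φ`. An estimate `m` slightly below `λ₂` is harmless, because the hyperbolic angle of
`λ₂` is then at most `φ/4` (`momentumPoly_ratio`). The bound `φ ≥ s/(m+s)` with `s = √(λ₁²-m²)`
yields the accelerated step count.

Probability. The measure of a set of directions is the relative volume of its cone in the unit ball;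
a linear map that keeps the cone inside the ball bounds it by the inverse determinant
(`uniformSphere_le_of_scaling`). This gives the small-ball and cap bounds, and by Fubini the bound
for the minor. -/

/-! ### Measure estimates on the sphere. -/

open scoped Pointwise in
theorem uniformSphere_apply {d : ℕ} [NeZero d] {s : Set (Metric.sphere (0 : Vec d) 1)}
    (hs : MeasurableSet s) :
    uniformSphere d s = (volume (Metric.ball (0 : Vec d) 1))⁻¹ *
      volume (Set.Ioo (0 : ℝ) 1 • (Subtype.val '' s) : Set (Vec d)) := by
  have hd : ((d : ENNReal)) ≠ 0 := by simpa using NeZero.ne d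
  rw [uniformSphere, Measure.smul_apply, Measure.toSphere_apply_univ, Measure.toSphere_apply' _ hs,
    finrank_euclideanSpace_fin, smul_eq_mul,
    ENNReal.mul_inv (Or.inl hd) (Or.inl (ENNReal.natCast_ne_top d)), mul_mul_mul_comm,
    mul_comm (_⁻¹ : ENNReal) (d : ENNReal), mul_comm (_⁻¹ : ENNReal) (volume _),
    mul_comm (volume _) (_⁻¹ : ENNReal), ENNReal.mul_inv_cancel hd (ENNReal.natCast_ne_top d),
    one_mul]

instance instIsProbabilityMeasureUniformSphere (d : ℕ) [NeZero d] :
    IsProbabilityMeasure (uniformSphere d) := by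
  constructor
  rw [uniformSphere, Measure.smul_apply, smul_eq_mul]
  refine ENNReal.inv_mul_cancel ?_ (measure_ne_top _ _)
  rw [Measure.toSphere_apply_univ, finrank_euclideanSpace_fin]
  refine mul_ne_zero (by simpa using NeZero.ne d) ?_
  exact (Metric.measure_ball_pos _ _ one_pos).ne'

open scoped Pointwise in
/-- The measure of a set of directions which a stretching by `a` along `v i₀` and by `b` on the
orthogonal complement maps into the unit ball. -/
theorem uniformSphere_le_of_scaling {d : ℕ} [NeZero d] (v : OrthonormalBasis (Fin d) ℝ (Vec d))
    (i₀ : Fin d) {a b : ℝ} (ha : 0 < a) (hb : 0 < b) {s : Set (Metric.sphere (0 : Vec d) 1)}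
    (hs : MeasurableSet s)
    (h : ∀ x ∈ s, a ^ 2 * inner ℝ (v i₀) x.1 ^ 2 + b ^ 2 * (1 - inner ℝ (v i₀) x.1 ^ 2) ≤ 1) :
    uniformSphere d s ≤ ENNReal.ofReal (1 / (a * b ^ (d - 1))) := by
  classical
  set D : Fin d → ℝ := Function.update (fun _ => b) i₀ a with hD
  set T : Vec d →ₗ[ℝ] Vec d := Matrix.toLin v.toBasis v.toBasis (Matrix.diagonal D) with hT
  have hdet : LinearMap.det T = a * b ^ (d - 1) := by
    rw [hT, LinearMap.det_toLin, Matrix.det_diagonal, hD,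
      Finset.prod_update_of_mem (Finset.mem_univ _), Finset.prod_const,
      Finset.card_sdiff_of_subset (by simp)]
    simp
  have hcoord : ∀ x i, inner ℝ (v i) (T x) = D i * inner ℝ (v i) x := by
    intro x i
    have : T x = ∑ j, (D j * inner ℝ (v j) x) • v j := by
      rw [hT, Matrix.toLin_apply]
      refine Finset.sum_congr rfl fun j _ => ?_
      rw [Matrix.mulVec_diagonal]
      simp [OrthonormalBasis.repr_apply_apply]
    rw [this, v.orthonormal.inner_right_fintype]
  have hnorm : ∀ x, ‖T x‖ ^ 2 =
      a ^ 2 * inner ℝ (v i₀) x ^ 2 + b ^ 2 * (‖x‖ ^ 2 - inner ℝ (v i₀) x ^ 2) := by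
    intro x
    rw [← v.sum_sq_norm_inner_right (T x), ← v.sum_sq_norm_inner_right x,
      ← Finset.add_sum_erase _ _ (Finset.mem_univ i₀),
      ← Finset.add_sum_erase Finset.univ (fun i => ‖inner ℝ (v i) x‖ ^ 2) (Finset.mem_univ i₀)]
    simp only [hcoord, Real.norm_eq_abs, sq_abs, hD, Function.update_self]
    rw [Finset.sum_congr rfl (g := fun i => b ^ 2 * inner ℝ (v i) x ^ 2), ← Finset.mul_sum]
    · ring
    · intro i hi
      rw [Function.update_of_ne (Finset.ne_of_mem_erase hi)]
      ring
  rw [uniformSphere_apply hs]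
  set C : Set (Vec d) := Set.Ioo (0 : ℝ) 1 • (Subtype.val '' s) with hC
  -- The cone `C` over `s` stays in the unit ball under `T`, so `det T * vol C ≤ vol ball`.
  have hsub : T '' C ⊆ Metric.ball 0 1 := by
    rintro _ ⟨_, ⟨r, hr, _, ⟨x, hx, rfl⟩, rfl⟩, rfl⟩
    have hx1 : ‖x.1‖ = 1 := by simp
    have h1 : ‖T x.1‖ ^ 2 ≤ 1 := by
      rw [hnorm, hx1]
      simpa using h x hx
    have h2 : ‖T x.1‖ ≤ 1 := by
      nlinarith [norm_nonneg (T x.1)]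
    simp only [mem_ball_zero_iff, map_smul, norm_smul, Real.norm_eq_abs,
      abs_of_pos hr.1]
    nlinarith [hr.1, hr.2, norm_nonneg (T x.1)]
  have hpos : 0 < a * b ^ (d - 1) := by positivity
  have hvol : ENNReal.ofReal (a * b ^ (d - 1)) * volume C ≤ volume (Metric.ball (0 : Vec d) 1) := by
    have := measure_mono (μ := (volume : Measure (Vec d))) hsub
    rwa [Measure.addHaar_image_linearMap, hdet, abs_of_pos hpos] at this
  have hB0 : volume (Metric.ball (0 : Vec d) 1) ≠ 0 := (Metric.measure_ball_pos _ _ one_pos).ne'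
  have hBt : volume (Metric.ball (0 : Vec d) 1) ≠ ⊤ := measure_ball_lt_top.ne
  rw [one_div, ENNReal.ofReal_inv_of_pos hpos, ← ENNReal.div_eq_inv_mul]
  refine ENNReal.div_le_of_le_mul ?_
  rw [← ENNReal.div_eq_inv_mul]
  rw [ENNReal.le_div_iff_mul_le (Or.inl (by simpa using hpos)) (Or.inl ENNReal.ofReal_ne_top),
    mul_comm]
  exact hvol

theorem measurable_inner_sphere {d : ℕ} (u : Vec d) :
    Measurable fun x : Metric.sphere (0 : Vec d) 1 => inner ℝ u x.1 := by
  fun_prop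

/-- Small-ball bound: a uniform unit vector is rarely almost orthogonal to a given direction. -/
theorem uniformSphere_slab_le {d : ℕ} [NeZero d] {u : Vec d} (hu : ‖u‖ = 1) {t : ℝ} (ht : 0 < t) :
    uniformSphere d {x | |inner ℝ u x.1| < t} ≤ ENNReal.ofReal (4 * d * t) := by
  have hd : 1 ≤ d := Nat.one_le_iff_ne_zero.2 (NeZero.ne d)
  have hd' : (1 : ℝ) ≤ d := by exact_mod_cast hd
  set i₀ : Fin d := ⟨0, hd⟩
  obtain ⟨v, hv⟩ : ∃ v : OrthonormalBasis (Fin d) ℝ (Vec d), v i₀ = u := by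
    have ho : Orthonormal ℝ (Set.domRestrict ({i₀} : Set (Fin d)) fun _ => u) := by
      constructor
      · intro i
        simpa using hu
      · intro i j hij
        exact absurd (Subsingleton.elim i j) hij
    obtain ⟨v, hv⟩ := ho.exists_orthonormalBasis_extension_of_card_eq (by simp)
    exact ⟨v, hv i₀ rfl⟩
  -- The slab is stretched by `η / t` across and shrunk by `1 - η` along; it lands in the ball
  -- because `η² + (1-η)² ≤ 1`. With `η = 1/(2d)`, Bernoulli gives `(1-η)^(d-1) ≥ 1/2`.
  have hη : (0 : ℝ) < 1 / (2 * d) := by positivity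
  have hη' : (1 : ℝ) / (2 * d) ≤ 1 / 2 := by
    rw [div_le_div_iff₀ (by positivity) (by norm_num)]
    linarith
  set η : ℝ := 1 / (2 * d) with hηd
  have hb : 0 < 1 - η := by linarith
  refine (uniformSphere_le_of_scaling v i₀ (a := η / t) (b := 1 - η) (by positivity) hb
    (measurableSet_lt (measurable_inner_sphere u).abs measurable_const) ?_).trans ?_
  · intro x hx
    rw [hv]
    have hx' : |inner ℝ u x.1| < t := hx
    have h1 : inner ℝ u x.1 ^ 2 ≤ t ^ 2 := by
      rw [← sq_abs]
      exact pow_le_pow_left₀ (abs_nonneg _) hx'.le 2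
    have h2 : (η / t) ^ 2 * inner ℝ u x.1 ^ 2 ≤ η ^ 2 := by
      calc (η / t) ^ 2 * inner ℝ u x.1 ^ 2 ≤ (η / t) ^ 2 * t ^ 2 := by gcongr
        _ = η ^ 2 := by field_simp
    have h3 : (1 - η) ^ 2 * (1 - inner ℝ u x.1 ^ 2) ≤ (1 - η) ^ 2 := by
      nlinarith [sq_nonneg (1 - η), sq_nonneg (inner ℝ u x.1)]
    nlinarith
  · refine ENNReal.ofReal_le_ofReal ?_
    have h1 : (1 : ℝ) / 2 ≤ (1 - η) ^ (d - 1) := by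
      have := one_add_mul_le_pow (a := -η) (by linarith) (d - 1)
      rw [← sub_eq_add_neg] at this
      refine le_trans ?_ this
      have h4 : ((d - 1 : ℕ) : ℝ) ≤ d := by exact_mod_cast Nat.sub_le d 1
      have h5 : (d : ℝ) * η = 1 / 2 := by
        rw [hηd]
        field_simp
      nlinarith
    rw [div_le_iff₀ (by positivity)]
    have h6 : 4 * d * t * (η / t * (1 - η) ^ (d - 1)) = 2 * (1 - η) ^ (d - 1) := by
      rw [hηd]
      field_simp
      norm_num
    rw [h6]
    linarith

/-- A uniform unit vector is within `π/4` of a given line with exponentially small probability. -/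
theorem uniformSphere_cap_le {d : ℕ} (hd : 3 ≤ d) [NeZero d]
    (v : OrthonormalBasis (Fin d) ℝ (Vec d)) (i₀ : Fin d) :
    uniformSphere d {x | 1 / 2 < inner ℝ (v i₀) x.1 ^ 2} ≤
      ENNReal.ofReal (Real.exp (-(1 / 100) * d)) := by
  -- Since `a < b` and `a² + b² ≤ 2`, directions with squared coordinate above `1/2` stay in the
  -- ball, while the determinant grows like `b^(d-1)`. The numbers also leave room for the base case
  -- `d = 3`.
  refine (uniformSphere_le_of_scaling v i₀ (a := 4 / 5) (b := 23 / 20) (by norm_num) (by norm_num)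
    (measurableSet_lt measurable_const ((measurable_inner_sphere _).pow_const 2)) ?_).trans ?_
  · intro x hx
    have hx' : 1 / 2 < inner ℝ (v i₀) x.1 ^ 2 := hx
    nlinarith
  · refine ENNReal.ofReal_le_ofReal ?_
    rw [div_le_iff₀ (by positivity)]
    obtain ⟨n, rfl⟩ := Nat.exists_eq_add_of_le' hd
    have he : (1 : ℝ) - 1 / 100 ≤ Real.exp (-(1 / 100)) := by
      have := Real.add_one_le_exp (-(1 / 100) : ℝ)
      linarith
    have h1 : Real.exp (-(1 / 100) * ((n + 3 : ℕ) : ℝ)) = Real.exp (-(1 / 100)) ^ (n + 3) := by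
      rw [← Real.exp_nat_mul]
      ring_nf
    have h2 : n + 3 - 1 = n + 2 := rfl
    rw [h1, h2]
    calc (1 : ℝ) ≤ (99 / 100 * (23 / 20)) ^ n * ((99 / 100) ^ 3 * (4 / 5 * (23 / 20) ^ 2)) :=
          one_le_mul_of_one_le_of_one_le (one_le_pow₀ (by norm_num)) (by norm_num)
      _ = (99 / 100) ^ (n + 3) * (4 / 5 * (23 / 20) ^ (n + 2)) := by
        rw [mul_pow]
        ring
      _ ≤ _ := by
        gcongr
        linarith

/-- A pair of independent uniform unit vectors `q`, `w` rarely has a small `2 × 2` minor, relative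
to the length of the corresponding part of `q`. -/
theorem uniformSphere_prod_minor_le {d : ℕ} [NeZero d] (v : OrthonormalBasis (Fin d) ℝ (Vec d))
    {i j : Fin d} (hij : i ≠ j) {t : ℝ} (ht : 0 < t) :
    ((uniformSphere d).prod (uniformSphere d))
      {x | |inner ℝ (v i) x.1.1 * inner ℝ (v j) x.2.1 - inner ℝ (v j) x.1.1 * inner ℝ (v i) x.2.1|
        < t * √(inner ℝ (v i) x.1.1 ^ 2 + inner ℝ (v j) x.1.1 ^ 2)} ≤
      ENNReal.ofReal (4 * d * t) := by
  have hm : ∀ k, Measurable fun x : Metric.sphere (0 : Vec d) 1 => inner ℝ (v k) x.1 :=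
    fun k => measurable_inner_sphere _
  rw [Measure.prod_apply]
  · refine (lintegral_mono (g := fun _ => ENNReal.ofReal (4 * d * t)) fun q => ?_).trans (by simp)
    set b₁ := inner ℝ (v i) q.1 with hb₁
    set b₂ := inner ℝ (v j) q.1 with hb₂
    set r := √(b₁ ^ 2 + b₂ ^ 2) with hr
    simp only [Set.preimage_ofPred_eq]
    rcases (Real.sqrt_nonneg (b₁ ^ 2 + b₂ ^ 2)).eq_or_lt with h0 | hpos
    · refine le_trans (measure_mono (t := ∅) fun w hw => ?_) (by simp)
      have hw' := Set.mem_ofPred_eq ▸ hw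
      rw [← hb₁, ← hb₂, ← hr] at hw'
      have : r = 0 := h0.symm
      rw [this, mul_zero] at hw'
      exact absurd hw' (not_lt.2 (abs_nonneg _))
    · have hr2 : r ^ 2 = b₁ ^ 2 + b₂ ^ 2 := Real.sq_sqrt (by positivity)
      rw [← hr] at hpos
      -- For fixed `q` the minor equals `r * ⟨u, w⟩` with `u` a unit vector, so the section is a
      -- slab in `w`.
      set u : Vec d := r⁻¹ • (b₁ • v j - b₂ • v i) with hu
      have hvi : inner ℝ (v i) (v j) = 0 := v.orthonormal.2 hij
      have hun : ‖u‖ = 1 := by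
        have h1 : ‖b₁ • v j - b₂ • v i‖ ^ 2 = r ^ 2 := by
          rw [norm_sub_sq_real, inner_smul_left, inner_smul_right, real_inner_comm, hvi, norm_smul,
            norm_smul, v.orthonormal.1, v.orthonormal.1, hr2]
          simp
        have h2 : ‖b₁ • v j - b₂ • v i‖ = r :=
          (sq_eq_sq₀ (norm_nonneg _) hpos.le).1 h1
        rw [hu, norm_smul, h2, norm_inv, Real.norm_eq_abs, abs_of_pos hpos,
          inv_mul_cancel₀ hpos.ne']
      refine le_trans (measure_mono fun w hw => ?_) (uniformSphere_slab_le hun ht)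
      have hw' := Set.mem_ofPred_eq ▸ hw
      rw [← hb₁, ← hb₂, ← hr] at hw'
      have h3 : inner ℝ u w.1 = r⁻¹ * (b₁ * inner ℝ (v j) w.1 - b₂ * inner ℝ (v i) w.1) := by
        rw [hu, inner_smul_left, inner_sub_left, inner_smul_left, inner_smul_left]
        simp
      rw [Set.mem_ofPred_eq, h3, abs_mul, abs_inv, abs_of_pos hpos, inv_mul_lt_iff₀ hpos, mul_comm r]
      exact hw'
  · exact measurableSet_lt
      ((((hm i).comp measurable_fst).mul ((hm j).comp measurable_snd)).sub
        (((hm j).comp measurable_fst).mul ((hm i).comp measurable_snd))).abs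
      (measurable_const.mul ((((hm i).comp measurable_fst).pow_const 2).add
        (((hm j).comp measurable_fst).pow_const 2)).sqrt)

/-! ### The scalar momentum recurrence and its Chebyshev bounds. -/

/-- The scalar momentum recurrence `y_{n+2} = x y_{n+1} - β y_n` with `y_0 = 0`, `y_1 = 1`. -/
def momentumPoly (β x : ℝ) : ℕ → ℝ
  | 0 => 0
  | 1 => 1
  | n + 2 => x * momentumPoly β x (n + 1) - β * momentumPoly β x n

theorem momentumPoly_add_two (β x : ℝ) (n : ℕ) :
    momentumPoly β x (n + 2) = x * momentumPoly β x (n + 1) - β * momentumPoly β x n := rfl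

/-- This is `U_{n+1} = x U_n + T_{n+1}` for Chebyshev polynomials. It bounds the recurrence by
induction without dividing by `sin θ`, hence also at `θ = 0`. -/
theorem momentumPoly_cos (r θ : ℝ) (n : ℕ) :
    momentumPoly (r ^ 2) (2 * r * Real.cos θ) (n + 2) =
      r * Real.cos θ * momentumPoly (r ^ 2) (2 * r * Real.cos θ) (n + 1) +
        r ^ (n + 1) * Real.cos ((n + 1 : ℕ) * θ) := by
  induction n using Nat.twoStepInduction with
  | zero =>
    simp [momentumPoly]
    ring
  | one =>
    simp only [momentumPoly]
    have : ((1 + 1 : ℕ) : ℝ) * θ = 2 * θ := by norm_num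
    rw [this, Real.cos_two_mul]
    ring
  | more n ih1 ih2 =>
    have hc : Real.cos ((n + 2 + 1 : ℕ) * θ) + Real.cos ((n + 1 : ℕ) * θ) =
        2 * Real.cos θ * Real.cos ((n + 1 + 1 : ℕ) * θ) := by
      rw [Real.cos_add_cos]
      push_cast
      ring_nf
    rw [momentumPoly_add_two _ _ (n + 2), momentumPoly_add_two _ _ (n + 1)] at *
    have e : Real.cos ((n + 2 + 1 : ℕ) * θ) =
      2 * Real.cos θ * Real.cos ((n + 1 + 1 : ℕ) * θ) - Real.cos ((n + 1 : ℕ) * θ) := by linarith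
    rw [e]
    rw [momentumPoly_add_two _ _ n] at *
    linear_combination (2 * r * Real.cos θ) * ih2 - r ^ 2 * ih1

/-- The characteristic roots are `r e^φ` and `r e^{-φ}`; removing the first leaves a geometric
sequence in the second. All terms are positive, which yields sign and upper bound by induction. -/
theorem momentumPoly_cosh (r φ : ℝ) (n : ℕ) :
    momentumPoly (r ^ 2) (2 * r * Real.cosh φ) (n + 2) =
      r * Real.exp φ * momentumPoly (r ^ 2) (2 * r * Real.cosh φ) (n + 1) +
        r ^ (n + 1) * Real.exp (-φ) ^ (n + 1) := by
  have hee : Real.exp φ * Real.exp (-φ) = 1 := by rw [← Real.exp_add]; simp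
  induction n with
  | zero =>
    simp only [momentumPoly, Real.cosh_eq]
    ring
  | succ n ih =>
    rw [momentumPoly_add_two _ _ (n + 1)]
    rw [show 2 * r * Real.cosh φ = r * (Real.exp φ + Real.exp (-φ)) by
      rw [Real.cosh_eq]; ring] at *
    linear_combination (r * Real.exp (-φ)) * ih
      + r ^ 2 * hee * momentumPoly (r ^ 2) (r * (Real.exp φ + Real.exp (-φ))) (n + 1)

theorem abs_momentumPoly_le_of_le {r : ℝ} (hr : 0 < r) {x : ℝ} (hx0 : 0 ≤ x) (hx : x ≤ 2 * r)
    (n : ℕ) : |momentumPoly (r ^ 2) x (n + 1)| ≤ (n + 1) * r ^ n := by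
  obtain ⟨θ, rfl⟩ : ∃ θ, x = 2 * r * Real.cos θ := by
    refine ⟨Real.arccos (x / (2 * r)), ?_⟩
    rw [Real.cos_arccos, mul_div_cancel₀]
    · positivity
    · exact le_trans (by norm_num) (div_nonneg hx0 (by positivity))
    · exact (div_le_one (by positivity)).2 hx
  induction n with
  | zero => simp [momentumPoly]
  | succ n ih =>
    rw [momentumPoly_cos]
    refine (abs_add_le _ _).trans ?_
    rw [abs_mul, abs_mul, abs_mul, abs_of_pos hr, abs_of_pos (pow_pos hr _)]
    have h1 := Real.abs_cos_le_one θ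
    have h2 := Real.abs_cos_le_one (((n + 1 : ℕ) : ℝ) * θ)
    calc _ ≤ r * 1 * ((n + 1) * r ^ n) + r ^ (n + 1) * 1 := by gcongr
      _ = _ := by push_cast; ring

theorem momentumPoly_cosh_nonneg {r φ : ℝ} (hr : 0 < r) (n : ℕ) :
    0 ≤ momentumPoly (r ^ 2) (2 * r * Real.cosh φ) (n + 1) := by
  induction n with
  | zero => simp [momentumPoly]
  | succ n ih =>
    rw [momentumPoly_cosh]
    positivity

theorem momentumPoly_cosh_le {r φ : ℝ} (hr : 0 < r) (hφ : 0 ≤ φ) (n : ℕ) :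
    momentumPoly (r ^ 2) (2 * r * Real.cosh φ) (n + 1) ≤ (n + 1) * (r * Real.exp φ) ^ n := by
  induction n with
  | zero => simp [momentumPoly]
  | succ n ih =>
    rw [momentumPoly_cosh]
    have h1 : Real.exp (-φ) ≤ Real.exp φ := Real.exp_le_exp.2 (by linarith)
    calc _ ≤ r * Real.exp φ * ((n + 1) * (r * Real.exp φ) ^ n) +
          r ^ (n + 1) * Real.exp φ ^ (n + 1) := by gcongr
      _ = _ := by push_cast; ring

theorem momentumPoly_mul_sinh (r φ : ℝ) (n : ℕ) :
    momentumPoly (r ^ 2) (2 * r * Real.cosh φ) (n + 1) * Real.sinh φ =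
      r ^ n * Real.sinh ((n + 1 : ℕ) * φ) := by
  induction n using Nat.twoStepInduction with
  | zero => simp [momentumPoly]
  | one =>
    simp only [momentumPoly]
    have : ((1 + 1 : ℕ) : ℝ) * φ = 2 * φ := by norm_num
    rw [this, Real.sinh_two_mul]
    ring
  | more n ih1 ih2 =>
    have hc : Real.sinh ((n + 2 + 1 : ℕ) * φ) + Real.sinh ((n + 1 : ℕ) * φ) =
        2 * Real.cosh φ * Real.sinh ((n + 1 + 1 : ℕ) * φ) := by
      have e1 : ((n + 2 + 1 : ℕ) : ℝ) * φ = (n + 1 + 1 : ℕ) * φ + φ := by push_cast; ring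
      have e2 : ((n + 1 : ℕ) : ℝ) * φ = (n + 1 + 1 : ℕ) * φ - φ := by push_cast; ring
      rw [e1, e2, Real.sinh_add, Real.sinh_sub]
      ring
    rw [momentumPoly_add_two _ _ (n + 1)]
    linear_combination (2 * r * Real.cosh φ) * ih2 - r ^ 2 * ih1 - r ^ (n + 2) * hc

theorem nat_mul_sinh_le {y : ℝ} (hy : 0 ≤ y) (n : ℕ) : n * Real.sinh y ≤ Real.sinh (n * y) := by
  induction n with
  | zero => simp
  | succ n ih =>
    have h0 : 0 ≤ Real.sinh y := Real.sinh_nonneg_iff.2 hy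
    have h1 : 0 ≤ Real.sinh (n * y) := Real.sinh_nonneg_iff.2 (by positivity)
    push_cast
    rw [add_mul, one_mul, add_mul, one_mul, Real.sinh_add]
    nlinarith [Real.one_le_cosh y, Real.one_le_cosh (n * y)]

/-- Half the exponential rate is given up to keep the factor `n + 1`, which later cancels the same
factor in the upper bounds. With `y = (n+1)φ/2`, write `sinh 2y = 2 sinh y cosh y` and use `sinh y ≥
(n+1) sinh(φ/2)` and `2 cosh y ≥ e^y`. -/
theorem le_momentumPoly_cosh {r φ : ℝ} (hr : 0 < r) (hφ : 0 < φ) (n : ℕ) :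
    (n + 1) * (r * Real.exp (φ / 2)) ^ n ≤
      2 * momentumPoly (r ^ 2) (2 * r * Real.cosh φ) (n + 1) := by
  have hs : 0 < Real.sinh φ := Real.sinh_pos_iff.2 hφ
  have hs2 : 0 < Real.sinh (φ / 2) := Real.sinh_pos_iff.2 (by linarith)
  refine le_of_mul_le_mul_right ?_ hs
  rw [mul_assoc 2, momentumPoly_mul_sinh]
  have h1 : Real.sinh φ ≤ 2 * Real.sinh (φ / 2) * Real.exp (φ / 2) := by
    have : φ = 2 * (φ / 2) := by ring
    rw [this, Real.sinh_two_mul, ← this]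
    have : Real.cosh (φ / 2) ≤ Real.exp (φ / 2) := by
      rw [Real.cosh_eq]
      have : Real.exp (-(φ / 2)) ≤ Real.exp (φ / 2) := Real.exp_le_exp.2 (by linarith)
      linarith
    gcongr
  have h2 : (n + 1 : ℕ) * Real.sinh (φ / 2) * Real.exp (φ / 2) ^ (n + 1) ≤
      Real.sinh ((n + 1 : ℕ) * φ) := by
    have e : ((n + 1 : ℕ) : ℝ) * φ = 2 * ((n + 1 : ℕ) * (φ / 2)) := by ring
    rw [e, Real.sinh_two_mul, ← Real.exp_nat_mul]
    set y := ((n + 1 : ℕ) : ℝ) * (φ / 2) with hy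
    have hc : Real.exp y ≤ 2 * Real.cosh y := by
      rw [Real.cosh_eq]
      have := Real.exp_pos (-y)
      linarith
    have h3 := nat_mul_sinh_le (y := φ / 2) (by linarith) (n + 1)
    rw [← hy] at h3
    have h4 : 0 ≤ Real.sinh y := Real.sinh_nonneg_iff.2 (by positivity)
    calc _ ≤ Real.sinh y * (2 * Real.cosh y) := by gcongr
      _ = _ := by ring
  calc _ ≤ (n + 1) * (r * Real.exp (φ / 2)) ^ n *
        (2 * Real.sinh (φ / 2) * Real.exp (φ / 2)) := by gcongr
    _ = 2 * r ^ n * ((n + 1 : ℕ) * Real.sinh (φ / 2) * Real.exp (φ / 2) ^ (n + 1)) := by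
      push_cast
      ring
    _ ≤ 2 * r ^ n * Real.sinh ((n + 1 : ℕ) * φ) := by gcongr
    _ = _ := by ring

/-- A quantitative comparison of hyperbolic angles. -/
theorem four_mul_le_of_cosh {ψ φ : ℝ} (hψ : 0 ≤ ψ) (hφ : 0 ≤ φ)
    (h1 : 99 * (Real.cosh ψ - 1) ≤ 1) (h2 : 100 * (Real.cosh ψ - 1) ≤ Real.cosh φ - 1) :
    4 * ψ ≤ φ := by
  have hc := Real.one_le_cosh ψ
  obtain ⟨a, ha⟩ : ∃ a, Real.cosh ψ = 1 + a := ⟨Real.cosh ψ - 1, by ring⟩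
  -- With `a = cosh ψ - 1`, `cosh 4ψ - 1 = 16a + 40a² + 32a³ + 8a⁴`, which is at most `100a` for `a
  -- ≤ 1/99`.
  have h4 : Real.cosh (4 * ψ) ≤ Real.cosh φ := by
    have : 4 * ψ = 2 * (2 * ψ) := by ring
    rw [this, Real.cosh_two_mul, Real.sinh_sq, Real.cosh_two_mul, Real.sinh_sq, ha]
    rw [ha] at h1 h2 hc
    have ha0 : 0 ≤ a := by linarith
    have ha1 : a ≤ 1 / 99 := by linarith
    have hsq : a * a ≤ 1 / 99 * a := by gcongr
    have hcu : a * a * a ≤ 1 / 99 * a := by nlinarith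
    have hqu : a * a * a * a ≤ 1 / 99 * a := by nlinarith
    nlinarith
  have := Real.cosh_le_cosh.1 h4
  rwa [abs_of_nonneg (by linarith), abs_of_nonneg hφ] at this

/-- Every point above `m` is of the form `m cosh φ`, with an explicit lower bound for `φ`. -/
theorem exists_eq_mul_cosh {m x : ℝ} (hm : 0 < m) (hx : m < x) :
    ∃ φ, 0 < φ ∧ m * Real.cosh φ = x ∧
      1 - (1 + √(x ^ 2 - m ^ 2) / m)⁻¹ ≤ φ := by
  have hxm : 0 < x ^ 2 - m ^ 2 := by nlinarith
  have hs : 0 < √(x ^ 2 - m ^ 2) := Real.sqrt_pos.2 hxm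
  set σ := √(x ^ 2 - m ^ 2) / m with hσ
  have hσ0 : 0 < σ := by positivity
  refine ⟨Real.arsinh σ, Real.arsinh_pos_iff.2 hσ0, ?_, ?_⟩
  · rw [Real.cosh_arsinh]
    have : 1 + σ ^ 2 = (x / m) ^ 2 := by
      rw [hσ, div_pow, div_pow, Real.sq_sqrt hxm.le]
      field_simp
      ring
    rw [this, Real.sqrt_sq (by positivity [hm.trans hx]), mul_div_cancel₀ _ hm.ne']
  · refine (Real.one_sub_inv_le_log_of_pos (by positivity)).trans ?_
    rw [Real.arsinh]
    refine Real.log_le_log (by positivity) ?_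
    have : 1 ≤ √(1 + σ ^ 2) := Real.one_le_sqrt.2 (by nlinarith)
    linarith

/-- The momentum recurrence damps every eigenvalue in `[0, l₂]` relative to `l₁`, at the
accelerated rate, provided that the momentum parameter `m / 2` is not much below `l₂ / 2`. -/
theorem momentumPoly_ratio {m l₁ l₂ ε : ℝ} {K : ℕ} (hm : 0 < m) (hml : m < l₁)
    (h1 : l₂ - m ≤ (l₁ - l₂) / 100) (h2 : l₂ - m ≤ l₂ / 100)
    (hε : 0 < ε) (hε1 : ε < 1)
    (hK : 4 * ((1 + √(m ^ 2 / 4) / √(l₁ ^ 2 - 4 * (m ^ 2 / 4))) * Real.log (1 / ε)) ≤ K) :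
    0 < momentumPoly (m ^ 2 / 4) l₁ (K + 1) ∧ ∀ x, 0 ≤ x → x ≤ l₂ →
      momentumPoly (m ^ 2 / 4) x (K + 1) ^ 2 ≤
        4 * ε * momentumPoly (m ^ 2 / 4) l₁ (K + 1) ^ 2 := by
  obtain ⟨r, rfl⟩ : ∃ r, m = 2 * r := ⟨m / 2, by ring⟩
  have hr : 0 < r := by linarith
  have e4 : (2 * r) ^ 2 / 4 = r ^ 2 := by ring
  simp only [e4] at hK ⊢
  obtain ⟨φ, hφ, hcosh, hφσ⟩ := exists_eq_mul_cosh hm hml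
  have hs : 0 < √(l₁ ^ 2 - (2 * r) ^ 2) := Real.sqrt_pos.2 (by nlinarith)
  have e5 : l₁ ^ 2 - 4 * r ^ 2 = l₁ ^ 2 - (2 * r) ^ 2 := by ring
  rw [Real.sqrt_sq hr.le, e5] at hK
  set s := √(l₁ ^ 2 - (2 * r) ^ 2) with hsd
  have hL : 0 < Real.log (1 / ε) := Real.log_pos ((one_lt_div hε).2 hε1)
  -- Here `φ ≥ s/(2r+s)`, and `(1 + r/s) * s/(2r+s) = (s+r)/(2r+s) ≥ 1/2`; the factor 4 in the step
  -- count thus gives `K φ ≥ 2 log(1/ε)`.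
  have hdecay : Real.exp (-(φ / 2)) ^ K ≤ ε := by
    rw [← Real.exp_nat_mul, ← Real.le_log_iff_exp_le hε]
    have h3 : 2 * Real.log (1 / ε) ≤ K * φ := by
      have e6 : 1 - (1 + s / (2 * r))⁻¹ = s / (2 * r + s) := by
        field_simp
        ring
      rw [e6] at hφσ
      have h5 : (1 : ℝ) / 2 ≤ (1 + r / s) * (s / (2 * r + s)) := by
        rw [show (1 + r / s) * (s / (2 * r + s)) = (s + r) / (2 * r + s) by field_simp,
          div_le_div_iff₀ (by norm_num) (by positivity)]
        linarith
      calc 2 * Real.log (1 / ε) = 4 * (1 / 2 * Real.log (1 / ε)) := by ring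
        _ ≤ 4 * ((1 + r / s) * (s / (2 * r + s)) * Real.log (1 / ε)) := by gcongr
        _ = 4 * ((1 + r / s) * Real.log (1 / ε)) * (s / (2 * r + s)) := by ring
        _ ≤ K * φ := by gcongr
    rw [one_div, Real.log_inv] at h3
    linarith
  have hcosh' : 2 * r * Real.cosh φ = l₁ := hcosh
  have hlow := le_momentumPoly_cosh hr hφ K
  rw [hcosh'] at hlow
  set N := momentumPoly (r ^ 2) l₁ (K + 1) with hN
  have hpow : 0 < ((K : ℝ) + 1) * (r * Real.exp (φ / 2)) ^ K := by positivity
  refine ⟨by linarith, fun x hx0 hx => ?_⟩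
  have hexp1 : 1 ≤ Real.exp (φ / 4) := Real.one_le_exp (by positivity)
  have hup : |momentumPoly (r ^ 2) x (K + 1)| ≤ (K + 1) * (r * Real.exp (φ / 4)) ^ K := by
    rcases le_or_gt x (2 * r) with hxm | hxm
    · refine (abs_momentumPoly_le_of_le hr hx0 hxm K).trans ?_
      gcongr
      nlinarith
    · obtain ⟨ψ, hψ, hψx, -⟩ := exists_eq_mul_cosh hm hxm
      -- Multiplied by `m`, the two conditions read `99 (x-m) ≤ m` and `100 (x-m) ≤ l₁-m`; both
      -- follow from `h2` and `h1` because `x ≤ l₂`.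
      have hψφ : 4 * ψ ≤ φ := by
        refine four_mul_le_of_cosh hψ.le hφ.le ?_ ?_
        · refine le_of_mul_le_mul_left ?_ hm
          nlinarith
        · refine le_of_mul_le_mul_left ?_ hm
          nlinarith
      rw [← hψx, abs_of_nonneg (momentumPoly_cosh_nonneg hr K)]
      refine (momentumPoly_cosh_le hr hψ.le K).trans ?_
      gcongr
      linarith
  have e7 : ((K + 1) * (r * Real.exp (φ / 4)) ^ K) ^ 2 =
      ((K + 1) * (r * Real.exp (φ / 2)) ^ K) ^ 2 * Real.exp (-(φ / 2)) ^ K := by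
    have : Real.exp (φ / 4) ^ 2 = Real.exp (φ / 2) ^ 2 * Real.exp (-(φ / 2)) := by
      rw [← Real.exp_nat_mul, ← Real.exp_nat_mul, ← Real.exp_add]
      congr 1
      push_cast
      ring
    calc ((K + 1) * (r * Real.exp (φ / 4)) ^ K) ^ 2 =
          (K + 1) ^ 2 * (r ^ K) ^ 2 * (Real.exp (φ / 4) ^ 2) ^ K := by
          rw [mul_pow r]
          ring
      _ = _ := by
          rw [this, mul_pow, mul_pow r]
          ring
  calc momentumPoly (r ^ 2) x (K + 1) ^ 2 = |momentumPoly (r ^ 2) x (K + 1)| ^ 2 := (sq_abs _).symm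
    _ ≤ ((K + 1) * (r * Real.exp (φ / 4)) ^ K) ^ 2 := by gcongr
    _ = ((K + 1) * (r * Real.exp (φ / 2)) ^ K) ^ 2 * Real.exp (-(φ / 2)) ^ K := e7
    _ ≤ (2 * N) ^ 2 * ε := by gcongr
    _ = 4 * ε * N ^ 2 := by ring

/-! ### Error recurrence for the deflation coefficients. -/

/-- A linear recurrence whose homogeneous factors `T ζ^(2j)` may be large at the start. -/
theorem le_of_growth_decay_recurrence {f : ℕ → ℝ} {T ζ B : ℝ} (hf : ∀ j, 0 ≤ f j) (hT : 1 ≤ T)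
    (hζ : 0 < ζ) (hζ1 : ζ ≤ 1) (hB : 0 ≤ B)
    (hrec : ∀ j, f (j + 1) ≤ T * ζ ^ (2 * j) * f j + B * ζ ^ j) {N : ℕ} (hN : T * ζ ^ N ≤ 1 / 2) :
    f (N + 1) ≤ T * ζ ^ N * (f 0 + 4 * B) := by
  set y := T * ζ ^ N with hy
  have hy0 : 0 < y := by positivity
  have hp : ∀ j k, (T * ζ ^ (N + j)) ^ k ≤ y ^ k := by
    intro j k
    refine pow_le_pow_left₀ (by positivity) ?_ k
    refine mul_le_mul_of_nonneg_left ?_ (by linarith)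
    exact pow_le_pow_of_le_one hζ.le hζ1 (Nat.le_add_right N j)
  have hyk : ∀ k, y ^ (k + 1) ≤ y * (1 / 2) ^ k := by
    intro k
    rw [pow_succ, mul_comm]
    gcongr
  -- Unrolling backwards from `N + 1`: the product of the factors `T ζ^(2i)` for `j ≤ i ≤ N` is
  -- exactly `(T ζ^(N+j))^k`, since the exponents sum to `(N+j)k`. The sources add up to a geometric
  -- series.
  have main : ∀ k j, j + k = N + 1 →
      f (N + 1) ≤ (T * ζ ^ (N + j)) ^ k * f j + B * (4 * y * (1 - (1 / 2) ^ k)) := by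
    intro k
    induction k with
    | zero =>
      intro j hj
      obtain rfl : j = N + 1 := by omega
      simp
    | succ k ih =>
      intro j hj
      have h1 := ih (j + 1) (by omega)
      have hjk : j + k = N := by omega
      set p := (T * ζ ^ (N + (j + 1))) ^ k with hpd
      have hp0 : 0 ≤ p := by positivity
      have h2 : p * (T * ζ ^ (2 * j)) = (T * ζ ^ (N + j)) ^ (k + 1) := by
        rw [hpd, mul_pow, mul_pow, ← pow_mul, ← pow_mul,
          show (N + j) * (k + 1) = (N + (j + 1)) * k + 2 * j by rw [← hjk]; ring, pow_add, pow_succ]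
        ring
      have h3 : p * ζ ^ j ≤ 2 * y * (1 / 2) ^ k := by
        cases k with
        | zero =>
          obtain rfl : j = N := by omega
          simp only [hpd, pow_zero, one_mul, mul_one]
          have : 0 < ζ ^ j := by positivity
          nlinarith
        | succ k =>
          have h4 : ζ ^ j ≤ 1 := pow_le_one₀ hζ.le hζ1
          calc p * ζ ^ j ≤ y ^ (k + 1) * 1 := by
                gcongr
                exact hp _ _
            _ ≤ y * (1 / 2) ^ k := by rw [mul_one]; exact hyk k
            _ = _ := by ring
      calc f (N + 1) ≤ p * f (j + 1) + B * (4 * y * (1 - (1 / 2) ^ k)) := h1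
        _ ≤ p * (T * ζ ^ (2 * j) * f j + B * ζ ^ j) + B * (4 * y * (1 - (1 / 2) ^ k)) := by
          gcongr
          exact hrec j
        _ = p * (T * ζ ^ (2 * j)) * f j + B * (p * ζ ^ j) + B * (4 * y * (1 - (1 / 2) ^ k)) := by
          ring
        _ ≤ (T * ζ ^ (N + j)) ^ (k + 1) * f j + B * (2 * y * (1 / 2) ^ k)
            + B * (4 * y * (1 - (1 / 2) ^ k)) := by
          rw [h2]
          gcongr
        _ = _ := by ring
  have h0 := main (N + 1) 0 (by omega)
  have h5 : (T * ζ ^ (N + 0)) ^ (N + 1) ≤ y := by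
    refine (hp 0 (N + 1)).trans ((hyk N).trans ?_)
    have : ((1 : ℝ) / 2) ^ N ≤ 1 := pow_le_one₀ (by norm_num) (by norm_num)
    nlinarith
  have h6 : (0 : ℝ) ≤ (1 / 2) ^ (N + 1) := by positivity
  calc f (N + 1) ≤ _ := h0
    _ ≤ y * f 0 + B * (4 * y * 1) := by
      gcongr
      · exact hf 0
      · linarith
    _ = _ := by ring

section Deflation

variable {ι : Type*} [Fintype ι]

/-- The moment `∑ λ_i^k x_i y_i`. -/
noncomputable def moment (lam x y : ι → ℝ) (k : ℕ) : ℝ := ∑ i, lam i ^ k * (x i * y i)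

/-- The coefficients `s_j` such that the unnormalized deflated iterates are `A^j (w₀ - s_j q₀)`,
where `a`, `b` are the coordinates of `w₀`, `q₀` in an eigenbasis. -/
noncomputable def shift (lam a b : ι → ℝ) : ℕ → ℝ
  | 0 => 0
  | j + 1 => shift lam a b j + moment lam b b (2 * j + 3) *
      (moment lam a b (2 * j + 1) - shift lam a b j * moment lam b b (2 * j + 1)) /
        moment lam b b (2 * j + 2) ^ 2

variable {lam a b : ι → ℝ} {i₀ : ι} {l₁ l₂ : ℝ}

theorem moment_pos (h0 : ∀ i, 0 ≤ lam i) (h1 : 0 < lam i₀) (hb : b i₀ ≠ 0) (k : ℕ) :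
    0 < moment lam b b k := by
  refine Finset.sum_pos' (fun i _ => ?_) ⟨i₀, Finset.mem_univ _, ?_⟩
  · exact mul_nonneg (pow_nonneg (h0 i) k) (mul_self_nonneg _)
  · exact mul_pos (pow_pos h1 k) (mul_self_pos.2 hb)

theorem le_moment (h0 : ∀ i, 0 ≤ lam i) (k : ℕ) : lam i₀ ^ k * b i₀ ^ 2 ≤ moment lam b b k := by
  rw [sq]
  exact Finset.single_le_sum (f := fun i => lam i ^ k * (b i * b i))
    (fun i _ => mul_nonneg (pow_nonneg (h0 i) k) (mul_self_nonneg _)) (Finset.mem_univ i₀)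

theorem moment_succ_le (h0 : ∀ i, 0 ≤ lam i) (h1 : ∀ i, lam i ≤ l₁) (k : ℕ) :
    moment lam b b (k + 1) ≤ l₁ * moment lam b b k := by
  rw [moment, moment, Finset.mul_sum]
  refine Finset.sum_le_sum fun i _ => ?_
  rw [pow_succ']
  have h2 : 0 ≤ lam i ^ k * (b i * b i) := mul_nonneg (pow_nonneg (h0 i) k) (mul_self_nonneg _)
  nlinarith [h1 i]

theorem moment_sq_le (h0 : ∀ i, 0 ≤ lam i) (k : ℕ) :
    moment lam b b (k + 1) ^ 2 ≤ moment lam b b k * moment lam b b (k + 2) := by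
  refine Finset.sum_sq_le_sum_mul_sum_of_sq_le_mul _ (fun i _ => ?_) (fun i _ => ?_)
    (fun i _ => ?_)
  · exact mul_nonneg (pow_nonneg (h0 i) k) (mul_self_nonneg _)
  · exact mul_nonneg (pow_nonneg (h0 i) _) (mul_self_nonneg _)
  · exact le_of_eq (by ring)

/-- With `M_k` the moments of `b`, the error is multiplied by `-(M₃M₁/M₂² - 1)`. Cauchy–Schwarz
makes the bracket nonnegative, and `M₃ ≤ l₁M₂` bounds it by `(l₁M₁ - M₂)/M₂`, a sum whose `i₀` term
vanishes. The `i₀` term of the source `R` vanishes as well, so both pieces are of order `l₂^(2j+1)`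
against a leading `l₁` power. -/
theorem abs_shift_sub_le [DecidableEq ι] (h0 : ∀ i, 0 ≤ lam i) (hl₁ : lam i₀ = l₁) (hl : 0 < l₁)
    (hl₂ : ∀ i, i ≠ i₀ → lam i ≤ l₂) (hl0 : 0 ≤ l₂) (hl21 : l₂ ≤ l₁) (ha : ∑ i, a i ^ 2 = 1)
    (hb : ∑ i, b i ^ 2 = 1) (hb0 : b i₀ ≠ 0) (j : ℕ) :
    |shift lam a b (j + 1) - a i₀ / b i₀| ≤
      (1 - b i₀ ^ 2) / b i₀ ^ 2 * (l₂ / l₁) ^ (2 * j + 1) * |shift lam a b j - a i₀ / b i₀| +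
        2 / |b i₀| ^ 3 * (l₂ / l₁) ^ (2 * j + 1) := by
  have hle : ∀ i, lam i ≤ l₁ := by
    intro i
    by_cases hi : i = i₀
    · rw [hi, hl₁]
    · exact (hl₂ i hi).trans hl21
  set M₁ := moment lam b b (2 * j + 1) with hM₁
  set M₂ := moment lam b b (2 * j + 2) with hM₂
  set M₃ := moment lam b b (2 * j + 3) with hM₃
  set R := moment lam a b (2 * j + 1) - a i₀ / b i₀ * M₁ with hR
  have hbp : 0 < |b i₀| := abs_pos.2 hb0
  have hb1 : b i₀ ^ 2 ≤ 1 := by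
    rw [← hb]
    exact Finset.single_le_sum (f := fun i => b i ^ 2) (fun i _ => sq_nonneg _) (Finset.mem_univ i₀)
  have ha1 : a i₀ ^ 2 ≤ 1 := by
    rw [← ha]
    exact Finset.single_le_sum (f := fun i => a i ^ 2) (fun i _ => sq_nonneg _) (Finset.mem_univ i₀)
  have hp0 : 0 < lam i₀ := hl₁ ▸ hl
  have hM₁p : 0 < M₁ := moment_pos h0 hp0 hb0 _
  have hM₂p : 0 < M₂ := moment_pos h0 hp0 hb0 _
  have hM₃p : 0 < M₃ := moment_pos h0 hp0 hb0 _
  have hM₂l : l₁ ^ (2 * j + 2) * b i₀ ^ 2 ≤ M₂ := by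
    rw [← hl₁]
    exact le_moment h0 _
  have h32 : M₃ ≤ l₁ * M₂ := moment_succ_le h0 hle _
  have hcs : M₂ ^ 2 ≤ M₁ * M₃ := moment_sq_le h0 _
  have hvar : l₁ * M₁ - M₂ ≤ l₁ * l₂ ^ (2 * j + 1) * (1 - b i₀ ^ 2) := by
    have e1 : l₁ * M₁ - M₂ = ∑ i, (l₁ - lam i) * lam i ^ (2 * j + 1) * b i ^ 2 := by
      rw [hM₁, hM₂, moment, moment, Finset.mul_sum, ← Finset.sum_sub_distrib]
      refine Finset.sum_congr rfl fun i _ => ?_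
      ring
    have e2 : 1 - b i₀ ^ 2 = ∑ i ∈ Finset.univ.erase i₀, b i ^ 2 := by
      rw [← hb, ← Finset.add_sum_erase _ _ (Finset.mem_univ i₀)]
      ring
    rw [e1, e2, Finset.mul_sum, ← Finset.add_sum_erase _ _ (Finset.mem_univ i₀), hl₁, sub_self,
      zero_mul, zero_mul, zero_add]
    refine Finset.sum_le_sum fun i hi => ?_
    have h1 := hl₂ i (Finset.ne_of_mem_erase hi)
    have h2 := h0 i
    have h3 : 0 ≤ l₁ - lam i := by linarith [hle i]
    gcongr
    linarith
  have hRb : |R| ≤ l₂ ^ (2 * j + 1) * (2 / |b i₀|) := by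
    have e1 : R = ∑ i, lam i ^ (2 * j + 1) * (b i * (a i * b i₀ - a i₀ * b i)) / b i₀ := by
      rw [hR, hM₁, moment, moment, Finset.mul_sum, ← Finset.sum_sub_distrib]
      refine Finset.sum_congr rfl fun i _ => ?_
      field_simp
    have h2 : ∑ i, (2⁻¹ * (a i ^ 2 + b i ^ 2) + b i ^ 2) = 2 := by
      rw [Finset.sum_add_distrib, ← Finset.mul_sum, Finset.sum_add_distrib, ha, hb]
      norm_num
    rw [e1, ← h2, Finset.sum_div, Finset.mul_sum]
    refine (Finset.abs_sum_le_sum_abs _ _).trans (Finset.sum_le_sum fun i _ => ?_)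
    rw [abs_div, ← mul_div_assoc]
    refine div_le_div_of_nonneg_right ?_ hbp.le
    rw [abs_mul, abs_of_nonneg (pow_nonneg (h0 i) _)]
    by_cases hi : i = i₀
    · subst hi
      have : a i * b i - a i * b i = 0 := by ring
      rw [this, mul_zero, abs_zero, mul_zero]
      positivity
    · have h3 := hl₂ i hi
      have h4 := h0 i
      refine mul_le_mul (pow_le_pow_left₀ h4 h3 _) ?_ (abs_nonneg _) (by positivity)
      rw [abs_mul]
      have h5 : |a i * b i₀ - a i₀ * b i| ≤ |a i| + |b i| := by
        refine (abs_sub _ _).trans ?_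
        rw [abs_mul, abs_mul]
        have h6 : |b i₀| ≤ 1 := (sq_le_one_iff_abs_le_one _).1 hb1
        have h7 : |a i₀| ≤ 1 := (sq_le_one_iff_abs_le_one _).1 ha1
        nlinarith [abs_nonneg (a i), abs_nonneg (b i)]
      calc |b i| * |a i * b i₀ - a i₀ * b i| ≤ |b i| * (|a i| + |b i|) := by gcongr
        _ ≤ _ := by
          rw [← sq_abs (a i), ← sq_abs (b i)]
          nlinarith [sq_nonneg (|a i| - |b i|)]
  have hrec : shift lam a b (j + 1) - a i₀ / b i₀ =
      -(M₃ * M₁ / M₂ ^ 2 - 1) * (shift lam a b j - a i₀ / b i₀) + M₃ * R / M₂ ^ 2 := by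
    rw [shift, ← hM₁, ← hM₂, ← hM₃, hR]
    ring
  have hκ0 : 0 ≤ M₃ * M₁ / M₂ ^ 2 - 1 := by
    rw [sub_nonneg, one_le_div (by positivity)]
    linarith
  have hlow : 0 < l₁ ^ (2 * j + 2) * b i₀ ^ 2 := by positivity
  have hκ1 : M₃ * M₁ / M₂ ^ 2 - 1 ≤ (1 - b i₀ ^ 2) / b i₀ ^ 2 * (l₂ / l₁) ^ (2 * j + 1) := by
    have hb2 : 0 ≤ 1 - b i₀ ^ 2 := by linarith
    calc M₃ * M₁ / M₂ ^ 2 - 1 ≤ l₁ * M₂ * M₁ / M₂ ^ 2 - 1 := by gcongr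
      _ = (l₁ * M₁ - M₂) / M₂ := by field_simp
      _ ≤ l₁ * l₂ ^ (2 * j + 1) * (1 - b i₀ ^ 2) / (l₁ ^ (2 * j + 2) * b i₀ ^ 2) := by
        gcongr
      _ = _ := by
        rw [div_pow]
        field_simp
        ring
  have hRM : |M₃ * R / M₂ ^ 2| ≤ 2 / |b i₀| ^ 3 * (l₂ / l₁) ^ (2 * j + 1) := by
    rw [abs_div, abs_mul, abs_of_pos hM₃p, abs_of_pos (pow_pos hM₂p 2)]
    calc M₃ * |R| / M₂ ^ 2 ≤ l₁ * M₂ * (l₂ ^ (2 * j + 1) * (2 / |b i₀|)) / M₂ ^ 2 := by gcongr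
      _ = l₁ * (l₂ ^ (2 * j + 1) * (2 / |b i₀|)) / M₂ := by field_simp
      _ ≤ l₁ * (l₂ ^ (2 * j + 1) * (2 / |b i₀|)) / (l₁ ^ (2 * j + 2) * b i₀ ^ 2) := by gcongr
      _ = _ := by
        rw [div_pow, ← sq_abs (b i₀)]
        field_simp
        ring
  rw [hrec]
  refine (abs_add_le _ _).trans ?_
  rw [abs_mul, abs_neg, abs_of_nonneg hκ0]
  gcongr

end Deflation

/-! ### The iterations in eigenbasis coordinates. -/

section Coordinates

variable {d : ℕ} {A : Matrix (Fin d) (Fin d) ℝ} {lam : Fin d → ℝ}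
  {v : OrthonormalBasis (Fin d) ℝ (Vec d)}

theorem inner_matVec (hA : ∀ i, matVec A (v i) = lam i • v i) (x : Vec d) (i : Fin d) :
    inner ℝ (v i) (matVec A x) = lam i * inner ℝ (v i) x := by
  have h1 : ∀ y, matVec A y = Matrix.toLpLin 2 2 A y := fun y => rfl
  have h2 : matVec A x = ∑ j, (lam j * inner ℝ (v j) x) • v j := by
    conv_lhs => rw [← v.sum_repr x]
    rw [h1, map_sum]
    refine Finset.sum_congr rfl fun j _ => ?_
    rw [map_smul, ← h1, hA, smul_smul, v.repr_apply_apply, mul_comm]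
  rw [h2, v.orthonormal.inner_right_fintype]

theorem inner_eq_sum (x y : Vec d) :
    inner ℝ x y = ∑ i, inner ℝ (v i) x * inner ℝ (v i) y := by
  rw [← v.sum_inner_mul_inner x y]
  refine Finset.sum_congr rfl fun i _ => ?_
  rw [real_inner_comm]

theorem sum_inner_sq {x : Vec d} (hx : ‖x‖ = 1) : ∑ i, inner ℝ (v i) x ^ 2 = 1 := by
  have := v.sum_sq_norm_inner_right x
  simpa [hx] using this

theorem rayleigh_eq_sum (hA : ∀ i, matVec A (v i) = lam i • v i) (x : Vec d) :
    rayleigh A x = ∑ i, lam i * inner ℝ (v i) x ^ 2 := by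
  rw [rayleigh, inner_eq_sum (v := v)]
  refine Finset.sum_congr rfl fun i _ => ?_
  rw [inner_matVec hA]
  ring

theorem norm_normalize {x : Vec d} (hx : x ≠ 0) : ‖normalize x‖ = 1 := by
  rw [normalize, norm_smul, norm_inv, norm_norm, inv_mul_cancel₀ (norm_ne_zero_iff.2 hx)]

theorem ne_zero_of_inner_ne_zero {u x : Vec d} (h : inner ℝ u x ≠ 0) : x ≠ 0 := by
  rintro rfl
  simp at h

theorem inner_normalize (u x : Vec d) : inner ℝ u (normalize x) = ‖x‖⁻¹ * inner ℝ u x := by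
  rw [normalize, inner_smul_right]

theorem preMomentum_fst (hA : ∀ i, matVec A (v i) = lam i • v i) {q₀ : Vec d} (w₀ : Vec d)
    (hq : ‖q₀‖ = 1) {i₀ : Fin d} (hl : 0 < lam i₀) (hb : inner ℝ (v i₀) q₀ ≠ 0) (j : ℕ) :
    ‖(preMomentum A q₀ w₀ j).1‖ = 1 ∧ ∃ α : ℝ, 0 < α ∧
      ∀ i, inner ℝ (v i) (preMomentum A q₀ w₀ j).1 = α * (lam i ^ j * inner ℝ (v i) q₀) := by
  induction j with
  | zero => exact ⟨hq, 1, one_pos, fun i => by simp [preMomentum]⟩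
  | succ j ih =>
    obtain ⟨-, α, hα, h⟩ := ih
    have hne : matVec A (preMomentum A q₀ w₀ j).1 ≠ 0 := by
      refine ne_zero_of_inner_ne_zero (u := v i₀) ?_
      rw [inner_matVec hA, h]
      positivity
    refine ⟨norm_normalize hne, ‖matVec A (preMomentum A q₀ w₀ j).1‖⁻¹ * α,
      mul_pos (inv_pos.2 (norm_pos_iff.2 hne)) hα, fun i => ?_⟩
    rw [preMomentum, inner_normalize, inner_matVec hA, h]
    ring

/-- The nonzero minor keeps the iteration well defined: if a deflated vector vanished, one scalar
`s` would satisfy `a = s b` at both `i₀` and `i₁`, forcing the minor to be zero. -/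
theorem preMomentum_snd (hA : ∀ i, matVec A (v i) = lam i • v i) {q₀ w₀ : Vec d}
    (hq : ‖q₀‖ = 1) (hw : ‖w₀‖ = 1) {i₀ i₁ : Fin d} (hl : 0 < lam i₀) (hl₁ : 0 < lam i₁)
    (hb : inner ℝ (v i₀) q₀ ≠ 0)
    (hm : inner ℝ (v i₀) q₀ * inner ℝ (v i₁) w₀ - inner ℝ (v i₁) q₀ * inner ℝ (v i₀) w₀ ≠ 0)
    (j : ℕ) :
    ‖(preMomentum A q₀ w₀ j).2‖ = 1 ∧ ∃ η : ℝ, 0 < η ∧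
      ∀ i, inner ℝ (v i) (preMomentum A q₀ w₀ j).2 = η * (lam i ^ j * (inner ℝ (v i) w₀ -
        shift lam (fun k => inner ℝ (v k) w₀) (fun k => inner ℝ (v k) q₀) j *
          inner ℝ (v i) q₀)) := by
  set a : Fin d → ℝ := fun k => inner ℝ (v k) w₀ with ha
  set b : Fin d → ℝ := fun k => inner ℝ (v k) q₀ with hbd
  induction j with
  | zero => exact ⟨hw, 1, one_pos, fun i => by simp [preMomentum, shift]⟩
  | succ j ih =>
    obtain ⟨-, η, hη, h⟩ := ih
    obtain ⟨hq1, α, hα, hqα⟩ := preMomentum_fst hA w₀ hq hl hb (j + 1)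
    set q := (preMomentum A q₀ w₀ (j + 1)).1 with hqd
    set w := (preMomentum A q₀ w₀ j).2 with hwd
    have hα2 : α ^ 2 * moment lam b b (2 * j + 2) = 1 := by
      rw [← sum_inner_sq (v := v) hq1, moment, Finset.mul_sum]
      refine Finset.sum_congr rfl fun i _ => ?_
      rw [hqα]
      ring
    have hν : rayleigh A q = α ^ 2 * moment lam b b (2 * j + 3) := by
      rw [rayleigh_eq_sum hA, moment, Finset.mul_sum]
      refine Finset.sum_congr rfl fun i _ => ?_
      rw [hqα]
      ring
    have hqw : inner ℝ q w = α * η * (moment lam a b (2 * j + 1) -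
        shift lam a b j * moment lam b b (2 * j + 1)) := by
      rw [inner_eq_sum (v := v), moment, moment, Finset.mul_sum, ← Finset.sum_sub_distrib,
        Finset.mul_sum]
      refine Finset.sum_congr rfl fun i _ => ?_
      rw [hqα, h]
      ring
    have hM : moment lam b b (2 * j + 2) ≠ 0 := fun h0 => by
      rw [h0, mul_zero] at hα2
      exact zero_ne_one hα2
    have hcoord : ∀ i, inner ℝ (v i) (deflate A q w) =
        η * (lam i ^ (j + 1) * (a i - shift lam a b (j + 1) * b i)) := by
      intro i
      have e1 : α ^ 2 = 1 / moment lam b b (2 * j + 2) := by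
        rw [eq_div_iff hM]
        exact hα2
      have e2 : rayleigh A q * inner ℝ q w * (α * (lam i ^ (j + 1) * b i)) =
          η * lam i ^ (j + 1) * (moment lam b b (2 * j + 3) * (moment lam a b (2 * j + 1) -
            shift lam a b j * moment lam b b (2 * j + 1)) / moment lam b b (2 * j + 2) ^ 2) *
              b i := by
        rw [hν, hqw]
        have e3 : ∀ M N : ℝ, α ^ 2 * M * (α * η * N) * (α * (lam i ^ (j + 1) * b i)) =
            α ^ 2 * α ^ 2 * (M * N * η * lam i ^ (j + 1) * b i) := fun M N => by ring
        rw [e3, e1]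
        field_simp
      rw [deflate, inner_sub_right, inner_smul_right, inner_matVec hA, h, hqα, e2, shift]
      ring
    have hne : deflate A q w ≠ 0 := by
      by_contra h0
      have h1 : ∀ i, 0 < lam i → a i - shift lam a b (j + 1) * b i = 0 := by
        intro i hi
        have := hcoord i
        rw [h0, inner_zero_right] at this
        have hp : η * lam i ^ (j + 1) ≠ 0 := by positivity
        rw [← mul_assoc] at this
        exact (mul_eq_zero.1 this.symm).resolve_left hp
      refine hm ?_
      have h2 := h1 i₀ hl
      have h3 := h1 i₁ hl₁
      show b i₀ * a i₁ - b i₁ * a i₀ = 0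
      linear_combination b i₀ * h3 - b i₁ * h2
    refine ⟨norm_normalize hne, ‖deflate A q w‖⁻¹ * η,
      mul_pos (inv_pos.2 (norm_pos_iff.2 hne)) hη, fun i => ?_⟩
    have e : (preMomentum A q₀ w₀ (j + 1)).2 = normalize (deflate A q w) := rfl
    rw [e, inner_normalize, hcoord]
    ring

/-- The initial previous iterate `0` matches `momentumPoly β x 0 = 0`, so the current iterate after
`k` steps carries index `k + 1`. Nonvanishing at `i₀` ensures that no normalization divides by zero.
-/
theorem momentum_coord (hA : ∀ i, matVec A (v i) = lam i • v i) {β : ℝ} {q : Vec d}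
    (hq : ‖q‖ = 1) {i₀ : Fin d} (hb : inner ℝ (v i₀) q ≠ 0)
    (hpos : ∀ n, momentumPoly β (lam i₀) (n + 1) ≠ 0) (k : ℕ) :
    ‖(momentum A β q k).2‖ = 1 ∧ ∃ α : ℝ, 0 < α ∧ ∀ i,
      inner ℝ (v i) (momentum A β q k).1 = α * (momentumPoly β (lam i) k * inner ℝ (v i) q) ∧
      inner ℝ (v i) (momentum A β q k).2 =
        α * (momentumPoly β (lam i) (k + 1) * inner ℝ (v i) q) := by
  induction k with
  | zero => exact ⟨hq, 1, one_pos, fun i => by simp [momentum, momentumPoly]⟩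
  | succ k ih =>
    obtain ⟨-, α, hα, h⟩ := ih
    set y := matVec A (momentum A β q k).2 - β • (momentum A β q k).1 with hy
    have hcoord : ∀ i, inner ℝ (v i) y =
        α * (momentumPoly β (lam i) (k + 2) * inner ℝ (v i) q) := by
      intro i
      rw [hy, inner_sub_right, inner_smul_right, inner_matVec hA, (h i).1, (h i).2,
        momentumPoly_add_two]
      ring
    have hne : y ≠ 0 := by
      refine ne_zero_of_inner_ne_zero (u := v i₀) ?_
      rw [hcoord]
      exact mul_ne_zero hα.ne' (mul_ne_zero (hpos (k + 1)) hb)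
    have e : momentum A β q (k + 1) = (‖y‖⁻¹ • (momentum A β q k).2, normalize y) := rfl
    rw [e]
    refine ⟨norm_normalize hne, ‖y‖⁻¹ * α, mul_pos (inv_pos.2 (norm_pos_iff.2 hne)) hα,
      fun i => ⟨?_, ?_⟩⟩
    · rw [inner_smul_right, (h i).2]
      ring
    · rw [inner_normalize, hcoord]
      ring

/-- Convergence of the momentum phase from a start vector in the cone `tan² θ(q, v i₀) ≤ 1/8`. -/
theorem sinSq_momentum_lt (hA : ∀ i, matVec A (v i) = lam i • v i) (h0 : ∀ i, 0 ≤ lam i)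
    {q : Vec d} (hq : ‖q‖ = 1) {i₀ : Fin d} (hb : 8 / 9 ≤ inner ℝ (v i₀) q ^ 2)
    {m l₂ ε : ℝ} {K : ℕ} (hm : 0 < m) (hml : m < lam i₀)
    (hl₂ : ∀ i, i ≠ i₀ → lam i ≤ l₂) (h1 : l₂ - m ≤ (lam i₀ - l₂) / 100)
    (h2 : l₂ - m ≤ l₂ / 100) (hε : 0 < ε) (hε1 : ε < 1)
    (hK : 4 * ((1 + √(m ^ 2 / 4) / √(lam i₀ ^ 2 - 4 * (m ^ 2 / 4))) * Real.log (1 / ε)) ≤ K) :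
    sinSq (momentum A (m ^ 2 / 4) q K).2 (v i₀) < ε := by
  classical
  obtain ⟨hpos, hrat⟩ := momentumPoly_ratio hm hml h1 h2 hε hε1 hK
  have hb0 : inner ℝ (v i₀) q ≠ 0 := by
    rintro h
    rw [h] at hb
    norm_num at hb
  have hne : ∀ n, momentumPoly (m ^ 2 / 4) (lam i₀) (n + 1) ≠ 0 := by
    intro n
    obtain ⟨φ, hφ, hc, -⟩ := exists_eq_mul_cosh hm hml
    have := le_momentumPoly_cosh (r := m / 2) (by linarith) hφ n
    rw [show 2 * (m / 2) * Real.cosh φ = lam i₀ by rw [← hc]; ring,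
      show (m / 2) ^ 2 = m ^ 2 / 4 by ring] at this
    have h3 : 0 < ((n : ℝ) + 1) * (m / 2 * Real.exp (φ / 2)) ^ n := by positivity
    linarith
  obtain ⟨hr, α, hα, hcoord⟩ := momentum_coord hA hq hb0 hne K
  set r := (momentum A (m ^ 2 / 4) q K).2 with hrd
  set P := momentumPoly (m ^ 2 / 4) (lam i₀) (K + 1) with hP
  have hsum := sum_inner_sq (v := v) hr
  have hqsum := sum_inner_sq (v := v) hq
  rw [← Finset.add_sum_erase _ _ (Finset.mem_univ i₀)] at hsum hqsum
  have hle : ∑ i ∈ Finset.univ.erase i₀, inner ℝ (v i) r ^ 2 ≤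
      α ^ 2 * (4 * ε * P ^ 2) * ∑ i ∈ Finset.univ.erase i₀, inner ℝ (v i) q ^ 2 := by
    rw [Finset.mul_sum]
    refine Finset.sum_le_sum fun i hi => ?_
    have := hrat (lam i) (h0 i) (hl₂ i (Finset.ne_of_mem_erase hi))
    rw [(hcoord i).2, mul_pow, mul_pow, mul_assoc]
    gcongr
  have hr0 : inner ℝ (v i₀) r ^ 2 = α ^ 2 * P ^ 2 * inner ℝ (v i₀) q ^ 2 := by
    rw [(hcoord i₀).2]
    ring
  set Q := inner ℝ (v i₀) q ^ 2 with hQ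
  have hQs : ∑ i ∈ Finset.univ.erase i₀, inner ℝ (v i) q ^ 2 = 1 - Q := by linarith
  rw [sinSq, real_inner_comm]
  have hαP : 0 < α ^ 2 * P ^ 2 := by positivity
  have h3 : 1 - inner ℝ (v i₀) r ^ 2 ≤ 4 * ε * (α ^ 2 * P ^ 2 * (1 - Q)) := by
    rw [hQs] at hle
    linarith
  -- `Q ≥ 8/9` means `1 - Q ≤ Q/8`, which turns the factor `4ε` into `ε/2`.
  have h4 : α ^ 2 * P ^ 2 * (1 - Q) ≤ 1 / 8 * (α ^ 2 * P ^ 2 * Q) := by nlinarith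
  have h5 : α ^ 2 * P ^ 2 * Q ≤ 1 := by
    rw [← hr0, ← hsum]
    have : 0 ≤ ∑ i ∈ Finset.univ.erase i₀, inner ℝ (v i) r ^ 2 :=
      Finset.sum_nonneg fun i _ => sq_nonneg _
    linarith
  nlinarith

end Coordinates

/-! ### Accuracy of the estimate of the second eigenvalue. -/

section Deflation

variable {ι : Type*} [Fintype ι] [DecidableEq ι] {lam a b : ι → ℝ} {i₀ i₁ : ι} {l₁ l₂ l₃ l_d : ℝ}

/-- The large powers of `X` pay for the powers of `D` coming from `1/|b i₀| ≤ D⁴`, through `X² D ≤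
1`. The extra factor `(l₂/l₁)^(N+1)` is essential: the `i₀` coordinate of the deflated vector is
later amplified by `l₁^(N+1)`. -/
theorem abs_shift_sub_le_pow (h0 : ∀ i, 0 ≤ lam i) (hl₁ : lam i₀ = l₁)
    (hl₂ : ∀ i, i ≠ i₀ → lam i ≤ l₂) (hl0 : 0 < l₂) (hl21 : l₂ < l₁) (ha : ∑ i, a i ^ 2 = 1)
    (hb : ∑ i, b i ^ 2 = 1) {D X : ℝ} (hD : 0 < D) (hbD : 1 ≤ |b i₀| * D ^ 4)
    (hb2 : b i₀ ^ 2 ≤ 1 / 2) (hX : 0 < X) (hX2 : X ≤ 1 / 2) (hXD : X ^ 2 * D ≤ 1) {N : ℕ}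
    (hN : (l₂ / l₁) ^ N ≤ X ^ 100) :
    |shift lam a b (N + 1) - a i₀ / b i₀| ≤ (l₂ / l₁) ^ (N + 1) * X ^ 50 := by
  have hb0 : b i₀ ≠ 0 := by
    intro h
    rw [h] at hbD
    norm_num at hbD
  have hbp : 0 < |b i₀| := abs_pos.2 hb0
  have hl : 0 < l₁ := hl0.trans hl21
  set ζ := l₂ / l₁ with hζd
  have hζ : 0 < ζ := by positivity
  have hζ1 : ζ ≤ 1 := (div_le_one hl).2 hl21.le
  set T := (1 - b i₀ ^ 2) / b i₀ ^ 2 with hTd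
  have hT1 : 1 ≤ T := by
    rw [hTd, one_le_div (by positivity)]
    linarith
  have hinv : 1 / |b i₀| ≤ D ^ 4 := by
    rw [div_le_iff₀ hbp]
    linarith
  have hT : T ≤ D ^ 8 := by
    calc T ≤ 1 / b i₀ ^ 2 := by
          rw [hTd]
          gcongr
          nlinarith [sq_nonneg (b i₀)]
      _ = (1 / |b i₀|) ^ 2 := by rw [div_pow, sq_abs, one_pow]
      _ ≤ (D ^ 4) ^ 2 := by gcongr
      _ = D ^ 8 := by ring
  have hB : 2 / |b i₀| ^ 3 ≤ 2 * D ^ 12 := by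
    calc 2 / |b i₀| ^ 3 = 2 * (1 / |b i₀|) ^ 3 := by
          field_simp
      _ ≤ 2 * (D ^ 4) ^ 3 := by gcongr
      _ = _ := by ring
  have hD1 : 1 ≤ D := by
    by_contra h
    have h4 : D ^ 4 < 1 := pow_lt_one₀ hD.le (not_le.1 h) (by norm_num)
    have h5 : |b i₀| ≤ 1 := by
      rw [← sq_le_one_iff_abs_le_one]
      linarith
    nlinarith
  have ha1 : a i₀ ^ 2 ≤ 1 := by
    rw [← ha]
    exact Finset.single_le_sum (f := fun i => a i ^ 2) (fun i _ => sq_nonneg _) (Finset.mem_univ i₀)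
  -- After division by `ζ^j`, the source of order `ζ^(2j+1)` still decays like `ζ^j`, and the
  -- homogeneous factor becomes `T ζ^(2j)`.
  set f : ℕ → ℝ := fun j => |shift lam a b j - a i₀ / b i₀| / ζ ^ j with hf
  have hf0 : f 0 ≤ D ^ 4 := by
    have : |a i₀| ≤ 1 := (sq_le_one_iff_abs_le_one _).1 ha1
    simp only [hf, shift, zero_sub, abs_neg, abs_div, pow_zero, div_one]
    refine le_trans ?_ hinv
    gcongr
  have hrec : ∀ j, f (j + 1) ≤ T * ζ ^ (2 * j) * f j + 2 / |b i₀| ^ 3 * ζ ^ j := by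
    intro j
    have := abs_shift_sub_le h0 hl₁ hl hl₂ hl0.le hl21.le ha hb hb0 j
    rw [← hζd, ← hTd] at this
    simp only [hf]
    rw [div_le_iff₀ (by positivity)]
    refine this.trans (le_of_eq ?_)
    field_simp
    ring
  have hXD40 : X ^ 40 * D ^ 20 ≤ 1 := by
    calc X ^ 40 * D ^ 20 = (X ^ 2 * D) ^ 20 := by ring
      _ ≤ 1 := pow_le_one₀ (by positivity) hXD
  have hX1 : ∀ n, X ^ n ≤ (1 / 2) ^ n := fun n => pow_le_pow_left₀ hX.le hX2 n
  have hTz : T * ζ ^ N ≤ 1 / 2 := by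
    calc T * ζ ^ N ≤ D ^ 8 * X ^ 100 := by gcongr
      _ ≤ D ^ 20 * X ^ 100 := by
        gcongr
        norm_num
      _ = (X ^ 40 * D ^ 20) * X ^ 60 := by ring
      _ ≤ 1 * (1 / 2) ^ 60 := by
        gcongr
      _ ≤ 1 / 2 := by norm_num
  have hmain := le_of_growth_decay_recurrence (f := f) (fun j => by positivity) hT1 hζ hζ1
    (by positivity) hrec hTz
  have hfin : f (N + 1) ≤ X ^ 50 := by
    calc f (N + 1) ≤ T * ζ ^ N * (f 0 + 4 * (2 / |b i₀| ^ 3)) := hmain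
      _ ≤ D ^ 8 * X ^ 100 * (D ^ 12 + 4 * (2 * D ^ 12)) := by
        have h412 : D ^ 4 ≤ D ^ 12 := pow_le_pow_right₀ hD1 (by norm_num)
        gcongr
        exact hf0.trans h412
      _ = 9 * X ^ 10 * (X ^ 40 * D ^ 20) * X ^ 50 := by ring
      _ ≤ 9 * (1 / 2) ^ 10 * 1 * X ^ 50 := by
        gcongr
      _ ≤ X ^ 50 := by
        have : 0 < X ^ 50 := by positivity
        norm_num
        linarith
  have := (div_le_iff₀ (by positivity)).1 hfin
  rwa [mul_comm] at this

set_option maxHeartbeats 1000000 in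
/-- The Rayleigh quotient of the deflated iterate approximates the second eigenvalue. -/
theorem rayleigh_shift_bounds (h0 : ∀ i, 0 ≤ lam i) (hl₁ : lam i₀ = l₁)
    (hl₂ : lam i₁ = l₂) (hl₃ : ∀ i, i ≠ i₀ → i ≠ i₁ → lam i ≤ l₃) (hl_d : ∀ i, l_d ≤ lam i)
    (hl32 : l₃ < l₂) (hl21 : l₂ < l₁) (hl1 : l₁ ≤ 1) (ha : ∑ i, a i ^ 2 = 1)
    (hb : ∑ i, b i ^ 2 = 1) {D X ρ : ℝ} (hD : 1 ≤ D) (hbD : 1 ≤ |b i₀| * D ^ 4)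
    (hm : |b i₀| ≤ |b i₀ * a i₁ - b i₁ * a i₀| * D ^ 4)
    (hρ : 0 < ρ) (hρ2 : ρ ≤ 1 / 2)
    (hX : 0 < X) (hX2 : X ≤ 1 / 2) (hXρ : X ≤ ρ) (hXD : X ^ 2 * D ≤ 1) {J : ℕ} {s η : ℝ}
    (hs : |s - a i₀ / b i₀| ≤ (l₂ / l₁) ^ J * X ^ 50) (hη : 0 < η) {w : ι → ℝ}
    (hw : ∑ i, w i ^ 2 = 1) (hws : ∀ i, w i = η * (lam i ^ J * (a i - s * b i)))
    (hl3 : 0 ≤ l₃) (hld0 : 0 ≤ l_d) (hJ : (l₃ / l₂) ^ J ≤ (ρ / D) ^ 200) :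
    |∑ i, lam i * w i ^ 2 - l₂| < ρ ∧ ∑ i, lam i * w i ^ 2 < l₁ ∧
      l₂ - ∑ i, lam i * w i ^ 2 ≤ (l₂ - l_d) * (ρ ^ 2 / 100) := by
  have hD0 : 0 < D := by linarith
  have hb0 : b i₀ ≠ 0 := by
    intro h
    rw [h] at hbD
    norm_num at hbD
  have hbp : 0 < |b i₀| := abs_pos.2 hb0
  have hl20 : 0 < l₂ := hl3.trans_lt hl32
  have hl : 0 < l₁ := hl20.trans hl21
  have habs : ∀ {x : ι → ℝ}, ∑ i, x i ^ 2 = 1 → ∀ i, |x i| ≤ 1 := by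
    intro x hx i
    rw [← sq_le_one_iff_abs_le_one, ← hx]
    exact Finset.single_le_sum (f := fun i => x i ^ 2) (fun i _ => sq_nonneg _) (Finset.mem_univ i)
  have hinv : 1 / |b i₀| ≤ D ^ 4 := by
    rw [div_le_iff₀ hbp]
    linarith
  set e := s - a i₀ / b i₀ with he
  have hse : s = e + a i₀ / b i₀ := by ring
  have hX1 : ∀ n, X ^ n ≤ (1 / 2) ^ n := fun n => pow_le_pow_left₀ hX.le hX2 n
  have hζ : (l₂ / l₁) ^ J ≤ 1 := pow_le_one₀ (by positivity) ((div_le_one hl).2 hl21.le)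
  have heX : |e| ≤ X ^ 50 := hs.trans (mul_le_of_le_one_left (by positivity) hζ)
  have hXD4 : X ^ 50 * D ^ 4 ≤ X ^ 42 := by
    calc X ^ 50 * D ^ 4 = X ^ 42 * (X ^ 2 * D) ^ 4 := by ring
      _ ≤ X ^ 42 * 1 := by
        gcongr
        exact pow_le_one₀ (by positivity) hXD
      _ = X ^ 42 := mul_one _
  set c : ι → ℝ := fun i => a i - s * b i with hc
  -- For the ideal shift the `i₁` coordinate is the minor divided by `b i₀`; the error `e` perturbs
  -- it by at most `X^50`.
  have hc₁ : 1 / 2 ≤ |c i₁| * D ^ 4 := by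
    have e1 : c i₁ = (b i₀ * a i₁ - b i₁ * a i₀) / b i₀ - e * b i₁ := by
      simp only [hc, hse]
      field_simp
      ring
    have h1 : 1 ≤ |(b i₀ * a i₁ - b i₁ * a i₀) / b i₀| * D ^ 4 := by
      rw [abs_div, div_mul_eq_mul_div, one_le_div hbp]
      exact hm
    have h2 : |e * b i₁| ≤ X ^ 50 := by
      rw [abs_mul]
      exact (mul_le_of_le_one_right (abs_nonneg _) (habs hb i₁)).trans heX
    have h3 := abs_sub_abs_le_abs_sub ((b i₀ * a i₁ - b i₁ * a i₀) / b i₀) (e * b i₁)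
    rw [← e1] at h3
    have h4 : X ^ 42 ≤ 1 / 2 := (hX1 42).trans (by norm_num)
    have h5 : (|(b i₀ * a i₁ - b i₁ * a i₀) / b i₀| - X ^ 50) * D ^ 4 ≤ |c i₁| * D ^ 4 := by
      gcongr
      linarith
    rw [sub_mul] at h5
    linarith
  have hw₁ : |w i₁| = η * l₂ ^ J * |c i₁| := by
    rw [hws, hl₂, abs_mul, abs_mul, abs_of_pos hη, abs_of_pos (pow_pos hl20 J), mul_assoc]
  -- The normalization is controlled by the `i₁` coordinate alone, as `|w i₁| ≤ 1`.
  have hηl : η * l₂ ^ J ≤ 2 * D ^ 4 := by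
    have h1 := habs hw i₁
    rw [hw₁] at h1
    have h2 : η * l₂ ^ J * (1 / 2) ≤ η * l₂ ^ J * (|c i₁| * D ^ 4) := by gcongr
    have h3 : η * l₂ ^ J * |c i₁| * D ^ 4 ≤ 1 * D ^ 4 := by gcongr
    rw [mul_assoc _ |c i₁|] at h3
    linarith
  have hc₁0 : 0 < |c i₁| := by
    by_contra h
    have : |c i₁| = 0 := le_antisymm (not_lt.1 h) (abs_nonneg _)
    rw [this] at hc₁
    norm_num at hc₁
  have hw₁0 : 0 < w i₁ ^ 2 := by
    rw [← sq_abs, hw₁]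
    positivity
  have hw₀ : |w i₀| ≤ 2 * X ^ 42 := by
    have e1 : a i₀ - s * b i₀ = -(e * b i₀) := by
      rw [hse]
      field_simp
      ring
    rw [hws, e1, hl₁, abs_mul, abs_mul, abs_neg, abs_mul, abs_of_pos hη, abs_of_pos (pow_pos hl J)]
    calc η * (l₁ ^ J * (|e| * |b i₀|)) ≤ η * (l₁ ^ J * ((l₂ / l₁) ^ J * X ^ 50 * 1)) := by
          gcongr
          exact habs hb i₀
      _ = η * l₂ ^ J * X ^ 50 := by
        rw [div_pow]
        field_simp
      _ ≤ 2 * D ^ 4 * X ^ 50 := by gcongr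
      _ = 2 * (X ^ 50 * D ^ 4) := by ring
      _ ≤ 2 * X ^ 42 := by gcongr
  have hle₂ : ∀ i, i ≠ i₀ → lam i ≤ l₂ := by
    intro i h
    by_cases h' : i = i₁
    · rw [h', hl₂]
    · exact (hl₃ i h h').trans hl32.le
  have hle₁ : ∀ i, lam i ≤ l₁ := by
    intro i
    by_cases h : i = i₀
    · rw [h, hl₁]
    · exact (hle₂ i h).trans hl21.le
  have hd2 : l_d ≤ l₂ := hl₂ ▸ hl_d i₁
  -- Only the `i₀` component can raise the quotient above `l₂`, by at most `(l₁-l₂) (w i₀)² ≤ (w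
  -- i₀)²`.
  have hupper : ∑ i, lam i * w i ^ 2 - l₂ < ρ := by
    have h1 : ∑ i, lam i * w i ^ 2 ≤ ∑ i, (l₂ * w i ^ 2 + if i = i₀ then w i ^ 2 else 0) := by
      refine Finset.sum_le_sum fun i _ => ?_
      split_ifs with h
      · rw [h, hl₁]
        nlinarith [sq_nonneg (w i₀)]
      · rw [add_zero]
        gcongr
        exact hle₂ i h
    rw [Finset.sum_add_distrib, ← Finset.mul_sum, hw, Finset.sum_ite_eq' Finset.univ i₀,
      if_pos (Finset.mem_univ _)] at h1
    have h2 : w i₀ ^ 2 < X := by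
      calc w i₀ ^ 2 = |w i₀| ^ 2 := (sq_abs _).symm
        _ ≤ (2 * X ^ 42) ^ 2 := by gcongr
        _ = 4 * X ^ 83 * X := by ring
        _ ≤ 4 * (1 / 2) ^ 83 * X := by
          gcongr
        _ < X := by
          norm_num
          linarith
    linarith
  have hlt : ∑ i, lam i * w i ^ 2 < l₁ := by
    have h1 : ∑ i, lam i * w i ^ 2 < ∑ i, l₁ * w i ^ 2 := by
      refine Finset.sum_lt_sum (fun i _ => ?_) ⟨i₁, Finset.mem_univ _, ?_⟩
      · gcongr
        exact hle₁ i
      · rw [hl₂]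
        gcongr
    rwa [← Finset.mul_sum, hw, mul_one] at h1
  have hs2 : |s| ≤ 2 * D ^ 4 := by
    have h1 : |a i₀ / b i₀| ≤ D ^ 4 := by
      rw [abs_div]
      refine le_trans ?_ hinv
      gcongr
      exact habs ha i₀
    have h2 : 1 ≤ D ^ 4 := one_le_pow₀ hD
    have h3 : |e| ≤ 1 := heX.trans ((hX1 50).trans (by norm_num))
    rw [hse]
    exact (abs_add_le _ _).trans (by linarith)
  have hcs : ∑ i, c i ^ 2 ≤ 10 * D ^ 8 := by
    have h1 : ∑ i, c i ^ 2 ≤ ∑ i, (2 * a i ^ 2 + 2 * s ^ 2 * b i ^ 2) := by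
      refine Finset.sum_le_sum fun i _ => ?_
      simp only [hc]
      nlinarith [sq_nonneg (a i + s * b i)]
    rw [Finset.sum_add_distrib, ← Finset.mul_sum, ← Finset.mul_sum, ha, hb] at h1
    have h2 : s ^ 2 ≤ 4 * D ^ 8 := by
      calc s ^ 2 = |s| ^ 2 := (sq_abs s).symm
        _ ≤ (2 * D ^ 4) ^ 2 := by gcongr
        _ = 4 * D ^ 8 := by ring
    have h3 : 1 ≤ D ^ 8 := one_le_pow₀ hD
    linarith
  -- Only components other than `i₀`, `i₁` lower the quotient; they are damped by `(l₃/l₂)^J`,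
  -- squared here. Keeping the factor `l₂ - l_d` makes the deficit comparable with `l₁ - l₂` under
  -- the assumption on `ρ`.
  have hlower : l₂ - ∑ i, lam i * w i ^ 2 ≤ (l₂ - l_d) * (ρ ^ 2 / 100) := by
    have e1 : l₂ - ∑ i, lam i * w i ^ 2 = ∑ i, (l₂ - lam i) * w i ^ 2 := by
      simp only [sub_mul]
      rw [Finset.sum_sub_distrib, ← Finset.mul_sum, hw, mul_one]
    set Y := (ρ / D) ^ 200 with hY
    have hterm : ∀ i, (l₂ - lam i) * w i ^ 2 ≤ (l₂ - l_d) * ((2 * D ^ 4 * Y) ^ 2 * c i ^ 2) := by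
      intro i
      have hR : 0 ≤ (l₂ - l_d) * ((2 * D ^ 4 * Y) ^ 2 * c i ^ 2) :=
        mul_nonneg (by linarith) (by positivity)
      by_cases h : i = i₀
      · refine le_trans ?_ hR
        rw [h, hl₁]
        nlinarith [sq_nonneg (w i₀)]
      by_cases h' : i = i₁
      · refine le_trans (le_of_eq ?_) hR
        rw [h', hl₂, sub_self, zero_mul]
      have h2 : η * lam i ^ J ≤ 2 * D ^ 4 * Y := by
        calc η * lam i ^ J ≤ η * l₃ ^ J := by
              have := h0 i
              gcongr
              exact hl₃ i h h'
          _ = η * l₂ ^ J * (l₃ / l₂) ^ J := by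
            rw [div_pow]
            field_simp
          _ ≤ 2 * D ^ 4 * Y := by gcongr
      have h3 : w i ^ 2 = (η * lam i ^ J) ^ 2 * c i ^ 2 := by
        rw [hws]
        simp only [hc]
        ring
      have h4 : 0 ≤ η * lam i ^ J := mul_nonneg hη.le (pow_nonneg (h0 i) J)
      rw [h3]
      have h5 : l₂ - lam i ≤ l₂ - l_d := by linarith [hl_d i]
      have h6 : 0 ≤ l₂ - l_d := by linarith
      gcongr
    rw [e1]
    refine (Finset.sum_le_sum fun i _ => hterm i).trans ?_
    rw [← Finset.mul_sum, ← Finset.mul_sum]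
    refine mul_le_mul_of_nonneg_left ?_ (by linarith)
    have h7 : Y ^ 2 * D ^ 16 ≤ ρ ^ 400 := by
      rw [hY, ← pow_mul, div_pow, div_mul_eq_mul_div, div_le_iff₀ (by positivity)]
      have : D ^ 16 ≤ D ^ (200 * 2) := pow_le_pow_right₀ hD (by norm_num)
      gcongr
    calc (2 * D ^ 4 * Y) ^ 2 * ∑ i, c i ^ 2 ≤ (2 * D ^ 4 * Y) ^ 2 * (10 * D ^ 8) := by gcongr
      _ = 40 * (Y ^ 2 * D ^ 16) := by ring
      _ ≤ 40 * (ρ ^ 398 * ρ ^ 2) := by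
        rw [← pow_add]
        gcongr
      _ ≤ 40 * ((1 / 2) ^ 20 * ρ ^ 2) := by
        have h9 : ρ ^ 398 ≤ (1 / 2) ^ 20 :=
          (pow_le_pow_of_le_one hρ.le (by linarith) (by norm_num : 20 ≤ 398)).trans
            (pow_le_pow_left₀ hρ.le hρ2 20)
        gcongr
      _ ≤ ρ ^ 2 / 100 := by
        norm_num
        linarith [sq_nonneg ρ]
  refine ⟨abs_lt.2 ⟨?_, hupper⟩, hlt, hlower⟩
  have h8 : (l₂ - l_d) * (ρ ^ 2 / 100) ≤ 1 * (ρ ^ 2 / 100) := by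
    gcongr
    linarith
  have h9 : ρ ^ 2 ≤ ρ := by
    rw [sq]
    exact mul_le_of_le_one_left hρ.le (by linarith)
  linarith

end Deflation

/-! ### Deterministic convergence from a good start. -/

theorem pow_le_pow_of_log_le {x u Y : ℝ} {n k : ℕ} (hx : 0 ≤ x) (hxu : x ≤ 1 - u) (hY : 0 < Y)
    (h : k * Real.log (1 / Y) ≤ n * u) : x ^ n ≤ Y ^ k := by
  have h1 : x ≤ Real.exp (-u) := hxu.trans (Real.one_sub_le_exp_neg u)
  calc x ^ n ≤ Real.exp (-u) ^ n := pow_le_pow_left₀ hx h1 n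
    _ = Real.exp (n * -u) := (Real.exp_nat_mul _ _).symm
    _ ≤ Real.exp (k * Real.log Y) := by
      refine Real.exp_le_exp.2 ?_
      rw [one_div, Real.log_inv] at h
      linarith
    _ = Y ^ k := by rw [Real.exp_nat_mul, Real.exp_log hY]

theorem eigenvalue_nonneg {d : ℕ} {A : Matrix (Fin d) (Fin d) ℝ} (hA : A.PosSemidef) {l : ℝ}
    {u : Vec d} (hu : ‖u‖ = 1) (h : matVec A u = l • u) : 0 ≤ l := by
  have h1 : inner ℝ u (matVec A u) = l := by
    rw [h, inner_smul_right, real_inner_self_eq_norm_sq, hu]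
    ring
  have h2 := hA.dotProduct_mulVec_nonneg u.ofLp
  rw [← h1, EuclideanSpace.inner_eq_star_dotProduct, matVec, dotProduct_comm]
  exact h2

theorem tan_lineAngle_sq {d : ℕ} {q v : Vec d} (hq : ‖q‖ = 1) (hv : ‖v‖ = 1) :
    Real.tan (lineAngle q v) ^ 2 = (1 - inner ℝ v q ^ 2) / inner ℝ v q ^ 2 := by
  have h1 : |inner ℝ v q| ≤ 1 := by
    have := abs_real_inner_le_norm v q
    rwa [hq, hv, one_mul] at this
  rw [lineAngle, Real.tan_arccos, div_pow, sq_abs, real_inner_comm, Real.sq_sqrt]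
  rw [sub_nonneg, sq_le_one_iff_abs_le_one]
  exact h1

/-- Plain power iteration contracts `tan²` of the angle by `(l₂/lam i₀)^(2J)`; `tan² ≤ 1/8` is the
same as `cos² ≥ 8/9`, the cone needed by the momentum phase. -/
theorem inner_sq_preMomentum_ge {d : ℕ} {A : Matrix (Fin d) (Fin d) ℝ} {lam : Fin d → ℝ}
    {v : OrthonormalBasis (Fin d) ℝ (Vec d)} (hA : ∀ i, matVec A (v i) = lam i • v i)
    (h0 : ∀ i, 0 ≤ lam i) {q₀ : Vec d} (w₀ : Vec d) (hq : ‖q₀‖ = 1) {i₀ : Fin d}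
    (hl : 0 < lam i₀) (hb : inner ℝ (v i₀) q₀ ≠ 0) {l₂ : ℝ} (hl₂ : ∀ i, i ≠ i₀ → lam i ≤ l₂)
    {J : ℕ} (hJ : (l₂ / lam i₀) ^ (2 * J) *
      ((1 - inner ℝ (v i₀) q₀ ^ 2) / inner ℝ (v i₀) q₀ ^ 2) ≤ 1 / 8) :
    8 / 9 ≤ inner ℝ (v i₀) (preMomentum A q₀ w₀ J).1 ^ 2 := by
  obtain ⟨hq1, α, hα, hc⟩ := preMomentum_fst hA w₀ hq hl hb J
  have hsum := sum_inner_sq (v := v) hq1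
  have hqs := sum_inner_sq (v := v) hq
  rw [← Finset.add_sum_erase _ _ (Finset.mem_univ i₀)] at hsum hqs
  set b := inner ℝ (v i₀) q₀ with hbd
  have h1 : ∑ i ∈ Finset.univ.erase i₀, inner ℝ (v i) (preMomentum A q₀ w₀ J).1 ^ 2 ≤
      α ^ 2 * l₂ ^ (2 * J) * (1 - b ^ 2) := by
    rw [show 1 - b ^ 2 = ∑ i ∈ Finset.univ.erase i₀, inner ℝ (v i) q₀ ^ 2 by linarith,
      Finset.mul_sum]
    refine Finset.sum_le_sum fun i hi => ?_
    have h2 := hl₂ i (Finset.ne_of_mem_erase hi)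
    have h3 := h0 i
    calc inner ℝ (v i) (preMomentum A q₀ w₀ J).1 ^ 2 =
          α ^ 2 * lam i ^ (2 * J) * inner ℝ (v i) q₀ ^ 2 := by
          rw [hc]
          ring
      _ ≤ _ := by gcongr
  set Q := inner ℝ (v i₀) (preMomentum A q₀ w₀ J).1 ^ 2 with hQ
  have hQ' : Q = α ^ 2 * lam i₀ ^ (2 * J) * b ^ 2 := by
    rw [hQ, hc]
    ring
  have hQ0 : 0 < Q := by
    rw [hQ']
    positivity
  have h4 : α ^ 2 * l₂ ^ (2 * J) * (1 - b ^ 2) =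
      (l₂ / lam i₀) ^ (2 * J) * ((1 - b ^ 2) / b ^ 2) * Q := by
    rw [hQ', div_pow]
    field_simp
  rw [h4] at h1
  have h5 := mul_le_mul_of_nonneg_right hJ hQ0.le
  linarith

set_option maxHeartbeats 1000000 in
/-- The deterministic part of the analysis: what happens for well-placed initial vectors. -/
theorem dmpower_of_good_start {d : ℕ} {A : Matrix (Fin d) (Fin d) ℝ} {lam : Fin d → ℝ}
    {v : OrthonormalBasis (Fin d) ℝ (Vec d)} {i₀ i₁ : Fin d} {l₁ l₂ l₃ l_d ε ρ τ δ : ℝ}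
    (hd : 1 ≤ d) (hA : ∀ i, matVec A (v i) = lam i • v i)
    (hl₁ : lam i₀ = l₁) (hl₂ : lam i₁ = l₂) (hl₃ : ∀ i, i ≠ i₀ → i ≠ i₁ → lam i ≤ l₃)
    (hl_d : ∀ i, l_d ≤ lam i) (hld0 : 0 ≤ l_d) (hd3 : l_d ≤ l₃) (h11 : l₁ ≤ 1) (h21 : l₂ < l₁)
    (h32 : l₃ < l₂) (hε : 0 < ε) (hε1 : ε < 1) (hρ : 0 < ρ)
    (hρ' : ρ < min (1 / 2) (√((l₁ - l₂) / (l₂ - l_d)))) (hτ : 1 < τ)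
    (hδ : δ = min ρ (1 / (τ * √d))) {q₀ w₀ : Vec d} (hq : ‖q₀‖ = 1) (hw : ‖w₀‖ = 1)
    (hb : 1 / (d * τ) ^ 4 ≤ |inner ℝ (v i₀) q₀|) (hb2 : inner ℝ (v i₀) q₀ ^ 2 ≤ 1 / 2)
    (hm : 1 / (d * τ) ^ 4 * √(inner ℝ (v i₀) q₀ ^ 2 + inner ℝ (v i₁) q₀ ^ 2) ≤
      |inner ℝ (v i₀) q₀ * inner ℝ (v i₁) w₀ - inner ℝ (v i₁) q₀ * inner ℝ (v i₀) w₀|)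
    {J : ℕ} (hJ : 200 * (1 / (l₁ - l₂) *
                Real.log (Real.tan (lineAngle q₀ (v i₀)) ^ 2 / (δ * (l₂ - l₃)))
              + l₂ / (l₂ - l₃) * Real.log (d * τ / ρ)) ≤ (J : ℝ)) :
    |mu A q₀ w₀ J - l₂| < ρ ∧ 4 * beta A q₀ w₀ J < l₁ ^ 2 ∧ ∀ K : ℕ,
      4 * ((1 + √(beta A q₀ w₀ J) / √(l₁ ^ 2 - 4 * beta A q₀ w₀ J)) * Real.log (1 / ε)) ≤ (K : ℝ) →
        sinSq (output A q₀ w₀ J K) (v i₀) < ε := by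
  have hρ2 : ρ < 1 / 2 := hρ'.trans_le (min_le_left _ _)
  have hl20 : 0 < l₂ := by linarith
  have hl10 : 0 < l₁ := by linarith
  have h0 : ∀ i, 0 ≤ lam i := fun i => hld0.trans (hl_d i)
  have hg : 0 < l₂ - l₃ := by linarith
  have hle₂ : ∀ i, i ≠ i₀ → lam i ≤ l₂ := by
    intro i h
    by_cases h' : i = i₁
    · rw [h', hl₂]
    · exact (hl₃ i h h').trans h32.le
  have hd' : (1 : ℝ) ≤ d := by exact_mod_cast hd
  have hD : 1 ≤ d * τ := one_le_mul_of_one_le_of_one_le hd' hτ.le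
  set D := d * τ with hDd
  have hD0 : 0 < D := by linarith
  have hsd : 1 ≤ √(d : ℝ) := Real.one_le_sqrt.2 hd'
  have hδ0 : 0 < δ := by
    rw [hδ]
    exact lt_min hρ (by positivity)
  have hδρ : δ ≤ ρ := hδ ▸ min_le_left _ _
  have hδτ : δ ≤ 1 / (τ * √d) := hδ ▸ min_le_right _ _
  set b := inner ℝ (v i₀) q₀ with hbd
  have hbD : 1 ≤ |b| * D ^ 4 := (div_le_iff₀ (by positivity)).1 hb
  have hbp : 0 < |b| := lt_of_lt_of_le (by positivity) hb
  have hb0 : b ≠ 0 := abs_pos.1 hbp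
  rw [tan_lineAngle_sq hq (v.orthonormal.1 i₀), ← hbd] at hJ
  set T := (1 - b ^ 2) / b ^ 2 with hT
  have hT1 : 1 ≤ T := by
    rw [hT, one_le_div (by positivity)]
    linarith
  -- `1/X` is the argument of the first logarithm in the bound on `J`. The two halves of `δ` give `X
  -- ≤ ρ` and `X² d τ ≤ 1`.
  set X := δ * (l₂ - l₃) / T with hX
  have hX0 : 0 < X := by positivity
  have hXT : X * T = δ * (l₂ - l₃) := div_mul_cancel₀ _ (by positivity)
  have hδg : δ * (l₂ - l₃) ≤ δ := mul_le_of_le_one_right hδ0.le (by linarith)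
  have hXδ : X ≤ δ := (div_le_self (by positivity) hT1).trans hδg
  have hXρ : X ≤ ρ := hXδ.trans hδρ
  have hX2 : X ≤ 1 / 2 := hXρ.trans hρ2.le
  have hXD : X ^ 2 * D ≤ 1 := by
    calc X ^ 2 * D ≤ (1 / (τ * √d)) ^ 2 * D := by
          gcongr
          exact hXδ.trans hδτ
      _ = 1 / τ := by
        rw [div_pow, mul_pow, Real.sq_sqrt (by positivity), hDd]
        field_simp
      _ ≤ 1 := (div_le_one (by linarith)).2 hτ.le
  have hlogX : 1 / 2 ≤ Real.log (1 / X) := by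
    have h1 : Real.log 2 ≤ Real.log (1 / X) := by
      refine Real.log_le_log (by norm_num) ?_
      rw [le_div_iff₀ hX0]
      linarith
    linarith [Real.log_two_gt_d9]
  have hlogD : 0 ≤ Real.log (D / ρ) := by
    refine Real.log_nonneg ?_
    rw [le_div_iff₀ hρ]
    linarith
  have hTX : T / (δ * (l₂ - l₃)) = 1 / X := by
    rw [hX, one_div_div]
  rw [hTX] at hJ
  have hΔ : 0 < l₁ - l₂ := by linarith
  have hnn1 : 0 ≤ 1 / (l₁ - l₂) * Real.log (1 / X) :=
    mul_nonneg (by positivity) (by linarith)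
  have hnn2 : 0 ≤ l₂ / (l₂ - l₃) * Real.log (D / ρ) := mul_nonneg (by positivity) hlogD
  have hJ1 : 200 * Real.log (1 / X) ≤ J * (l₁ - l₂) := by
    have : 200 * (1 / (l₁ - l₂) * Real.log (1 / X)) ≤ J := by linarith
    rw [one_div_mul_eq_div, ← mul_div_assoc, div_le_iff₀ hΔ] at this
    exact this
  have hJ2 : 200 * Real.log (D / ρ) ≤ J * ((l₂ - l₃) / l₂) := by
    have : 200 * (l₂ / (l₂ - l₃) * Real.log (D / ρ)) ≤ J := by linarith
    calc 200 * Real.log (D / ρ) =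
          200 * (l₂ / (l₂ - l₃) * Real.log (D / ρ)) * ((l₂ - l₃) / l₂) := by field_simp
      _ ≤ J * ((l₂ - l₃) / l₂) := by gcongr
  have hJ100 : (100 : ℝ) ≤ J := by
    have : (J : ℝ) * (l₁ - l₂) ≤ J * 1 := by
      gcongr
      linarith
    linarith
  obtain ⟨N, rfl⟩ : ∃ N, J = N + 1 := by
    refine ⟨J - 1, ?_⟩
    have : 100 ≤ J := by exact_mod_cast hJ100
    omega
  have hζ0 : 0 ≤ l₂ / l₁ := by positivity
  have hζ1 : l₂ / l₁ ≤ 1 := (div_le_one hl10).2 h21.le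
  -- `l₁ ≤ 1` gives `l₂/l₁ ≤ 1 - (l₁-l₂)`. Passing from `J = N + 1` to `N` costs at most a factor 2
  -- because `J ≥ 100`, hence exponent 100 from the constant 200.
  have hN : (l₂ / l₁) ^ N ≤ X ^ 100 := by
    refine pow_le_pow_of_log_le (u := l₁ - l₂) hζ0 ?_ hX0 ?_
    · rw [div_le_iff₀ hl10]
      have := mul_nonneg hΔ.le (sub_nonneg.2 h11)
      linarith only [this]
    · push_cast at hJ1 hJ100 ⊢
      have : ((N : ℝ) + 1) * (l₁ - l₂) ≤ 2 * N * (l₁ - l₂) := by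
        gcongr
        linarith
      linarith
  have hJ3 : (l₃ / l₂) ^ (N + 1) ≤ (ρ / D) ^ 200 := by
    refine pow_le_pow_of_log_le (u := (l₂ - l₃) / l₂) (div_nonneg (by linarith) hl20.le) ?_
      (by positivity) ?_
    · refine le_of_eq ?_
      field_simp
      ring
    · rw [one_div_div]
      exact_mod_cast hJ2
  have hζT : (l₂ / lam i₀) ^ (2 * (N + 1)) * T ≤ 1 / 8 := by
    rw [hl₁]
    calc (l₂ / l₁) ^ (2 * (N + 1)) * T ≤ (l₂ / l₁) ^ N * T := by
          refine mul_le_mul_of_nonneg_right ?_ (by positivity)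
          exact pow_le_pow_of_le_one hζ0 hζ1 (by omega)
      _ ≤ X ^ 100 * T := by gcongr
      _ = X ^ 99 * (X * T) := by ring
      _ ≤ (1 / 2) ^ 99 * 1 := by
        gcongr
        rw [hXT]
        linarith
      _ ≤ 1 / 8 := by norm_num
  have hQ := inner_sq_preMomentum_ge hA h0 w₀ hq (hl₁ ▸ hl10) hb0 hle₂ hζT
  have hmpos : |b| ≤ |b * inner ℝ (v i₁) w₀ - inner ℝ (v i₁) q₀ * inner ℝ (v i₀) w₀| * D ^ 4 := by
    have h1 : |b| ≤ √(b ^ 2 + inner ℝ (v i₁) q₀ ^ 2) := by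
      rw [← Real.sqrt_sq_eq_abs]
      exact Real.sqrt_le_sqrt (by linarith [sq_nonneg (inner ℝ (v i₁) q₀)])
    have h2 := (mul_le_mul_of_nonneg_left h1 (by positivity : 0 ≤ 1 / D ^ 4)).trans hm
    rw [one_div_mul_eq_div, div_le_iff₀ (by positivity)] at h2
    exact h2
  have hmne : b * inner ℝ (v i₁) w₀ - inner ℝ (v i₁) q₀ * inner ℝ (v i₀) w₀ ≠ 0 := by
    intro h
    rw [h, abs_zero, zero_mul] at hmpos
    linarith
  obtain ⟨hw1, η, hη, hwc⟩ := preMomentum_snd hA hq hw (hl₁ ▸ hl10) (hl₂ ▸ hl20) hb0 hmne (N + 1)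
  have hshift := abs_shift_sub_le_pow (lam := lam) (a := fun k => inner ℝ (v k) w₀)
    (b := fun k => inner ℝ (v k) q₀) h0 hl₁ hle₂ hl20 h21 (sum_inner_sq hw) (sum_inner_sq hq)
    hD0 hbD hb2 hX0 hX2 hXD hN
  obtain ⟨hmu, hmul, hmuge⟩ := rayleigh_shift_bounds (lam := lam) (a := fun k => inner ℝ (v k) w₀)
    (b := fun k => inner ℝ (v k) q₀) h0 hl₁ hl₂ hl₃ hl_d h32 h21 h11 (sum_inner_sq hw)
    (sum_inner_sq hq) hD hbD hmpos hρ hρ2.le hX0 hX2 hXρ hXD hshift hη (sum_inner_sq hw1) hwc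
    (by linarith) hld0 hJ3
  rw [← rayleigh_eq_sum hA] at hmu hmul hmuge
  have hmm : rayleigh A (preMomentum A q₀ w₀ (N + 1)).2 = mu A q₀ w₀ (N + 1) := rfl
  rw [hmm] at hmu hmul hmuge
  have hβ : beta A q₀ w₀ (N + 1) = mu A q₀ w₀ (N + 1) ^ 2 / 4 := rfl
  set m := mu A q₀ w₀ (N + 1) with hmd
  have hl2d : 0 < l₂ - l_d := by linarith
  -- This is where the square-root bound on `ρ` enters: it converts the deficit `(l₂-l_d) ρ²/100`
  -- into at most a hundredth of the gap `l₁ - l₂`.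
  have hρΔ : ρ ^ 2 * (l₂ - l_d) ≤ l₁ - l₂ := by
    have h1 : ρ < √((l₁ - l₂) / (l₂ - l_d)) := hρ'.trans_le (min_le_right _ _)
    have h2 := (Real.lt_sqrt hρ.le).1 h1
    exact ((lt_div_iff₀ hl2d).1 h2).le
  have h1 : l₂ - m ≤ (l₁ - l₂) / 100 := by linarith
  have h2 : l₂ - m ≤ l₂ / 100 := by
    have h3 : (l₂ - l_d) * (ρ ^ 2 / 100) ≤ l₂ * (1 / 100) := by
      have h4 : ρ ^ 2 ≤ 1 := pow_le_one₀ hρ.le (by linarith only [hρ2])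
      gcongr
      linarith only [hld0]
    linarith
  have hm0 : 0 < m := by linarith
  refine ⟨hmu, ?_, fun K hK => ?_⟩
  · rw [hβ, mul_div_cancel₀ _ (by norm_num : (4 : ℝ) ≠ 0)]
    exact pow_lt_pow_left₀ hmul hm0.le (by norm_num)
  · rw [hβ, ← hl₁] at hK
    exact sinSq_momentum_lt hA h0 (preMomentum_fst hA w₀ hq (hl₁ ▸ hl10) hb0 (N + 1)).1 hQ hm0
      (hl₁ ▸ hmul) hle₂ (hl₁ ▸ h1) h2 hε hε1 hK

/-! ### Union bound and conclusion. -/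

/-- The two slab-type events have total bound `8/(d³τ⁴)`, and `d³ ≥ 27` absorbs the 8. -/
theorem failure_probability_le {d : ℕ} (hd : 3 ≤ d) {τ : ℝ} (hτ : 1 < τ) :
    4 * d * (1 / (d * τ) ^ 4) + 4 * d * (1 / (d * τ) ^ 4) ≤ τ ^ (-(1 / 100) : ℝ) := by
  have hd' : (3 : ℝ) ≤ d := by exact_mod_cast hd
  have hτ0 : 0 < τ := by linarith
  calc 4 * d * (1 / (d * τ) ^ 4) + 4 * d * (1 / (d * τ) ^ 4) = 8 / (d ^ 3 * τ ^ 3) * (1 / τ) := by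
        field_simp
        norm_num
    _ ≤ 1 * (1 / τ) := by
      gcongr
      rw [div_le_one (by positivity)]
      have h1 : (3 : ℝ) ^ 3 ≤ (d : ℝ) ^ 3 := by gcongr
      have h2 : 1 ≤ τ ^ 3 := one_le_pow₀ hτ.le
      nlinarith
    _ = τ ^ (-1 : ℝ) := by rw [one_mul, Real.rpow_neg_one, one_div]
    _ ≤ τ ^ (-(1 / 100) : ℝ) := Real.rpow_le_rpow_of_exponent_le hτ.le (by norm_num)

end DMPower

theorem theorem2 :
    -- absolute constants: `c` in the failure probability, `C₁`, `C₂` in the step counts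
    ∃ c : ℝ, 0 < c ∧ ∃ C₁ : ℝ, 0 < C₁ ∧ ∃ C₂ : ℝ, 0 < C₂ ∧
    ∀ (d : ℕ) (hd : 3 ≤ d) (A : Matrix (Fin d) (Fin d) ℝ)
      (lam : Fin d → ℝ) (v : OrthonormalBasis (Fin d) ℝ (DMPower.Vec d))
      (l₁ l₂ l₃ l_d ε ρ τ δ : ℝ),
      -- spectrum `1 ≥ λ₁ > λ₂ > λ₃ ≥ ⋯ ≥ λ_d ≥ 0` of the symmetric PSD matrix `A`
      A.PosSemidef →
      (∀ i, DMPower.matVec A (v i) = lam i • v i) →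
      Antitone lam →
      l₁ = lam ⟨0, by omega⟩ → l₂ = lam ⟨1, by omega⟩ → l₃ = lam ⟨2, by omega⟩ →
      l_d = lam ⟨d - 1, by omega⟩ →
      l₁ ≤ 1 → l₂ < l₁ → l₃ < l₂ →
      -- parameters
      0 < ε → ε < 1 →
      0 < ρ → ρ < min (1 / 2) (Real.sqrt ((l₁ - l₂) / (l₂ - l_d))) →
      1 < τ → δ = min ρ (1 / (τ * Real.sqrt d)) →
      -- independent uniform unit vectors `q₀ = x.1`, `w₀ = x.2`: the exceptional event
      ((DMPower.uniformSphere d).prod (DMPower.uniformSphere d))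
        {x | ¬ ∀ J : ℕ,
          C₁ * (1 / (l₁ - l₂) *
                Real.log (Real.tan (DMPower.lineAngle x.1.1 (v ⟨0, by omega⟩)) ^ 2
                  / (δ * (l₂ - l₃)))
              + l₂ / (l₂ - l₃) * Real.log (d * τ / ρ)) ≤ (J : ℝ) →
          |DMPower.mu A x.1.1 x.2.1 J - l₂| < ρ ∧
          4 * DMPower.beta A x.1.1 x.2.1 J < l₁ ^ 2 ∧
          ∀ K : ℕ,
            C₂ * ((1 + Real.sqrt (DMPower.beta A x.1.1 x.2.1 J)
                    / Real.sqrt (l₁ ^ 2 - 4 * DMPower.beta A x.1.1 x.2.1 J))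
                * Real.log (1 / ε)) ≤ (K : ℝ) →
            DMPower.sinSq (DMPower.output A x.1.1 x.2.1 J K) (v ⟨0, by omega⟩) < ε}
        ≤ ENNReal.ofReal (τ ^ (-c) + Real.exp (-c * d)) := by
  -- `1/100` is the exponent of the cap estimate; 200 and 4 are the step-count constants of
  -- `dmpower_of_good_start`.
  refine ⟨1 / 100, by norm_num, 200, by norm_num, 4, by norm_num, ?_⟩
  intro d hd A lam v l₁ l₂ l₃ l_d ε ρ τ δ hpsd hA hanti h₁ h₂ h₃ h_d h11 h21 h32 hε hε1 hρ hρ' hτ hδ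
  have : NeZero d := ⟨by omega⟩
  set i₀ : Fin d := ⟨0, by omega⟩ with hi₀
  set i₁ : Fin d := ⟨1, by omega⟩ with hi₁
  have hi : i₀ ≠ i₁ := by simp [hi₀, hi₁]
  have hd0 : (0 : ℝ) < d := by
    have : 0 < d := by omega
    exact_mod_cast this
  have hlam0 : ∀ i, 0 ≤ lam i := fun i =>
    DMPower.eigenvalue_nonneg hpsd (v.orthonormal.1 i) (hA i)
  have hl₃ : ∀ i, i ≠ i₀ → i ≠ i₁ → lam i ≤ l₃ := by
    intro i hne0 hne1
    rw [h₃]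
    refine hanti ?_
    have h0 : i.val ≠ 0 := fun h => hne0 (Fin.ext h)
    have h1 : i.val ≠ 1 := fun h => hne1 (Fin.ext h)
    rw [Fin.le_def]
    show 2 ≤ i.val
    omega
  have hl_d : ∀ i, l_d ≤ lam i := by
    intro i
    rw [h_d]
    refine hanti ?_
    rw [Fin.le_def]
    show i.val ≤ d - 1
    omega
  set t : ℝ := 1 / (d * τ) ^ 4 with ht
  have ht0 : 0 < t := by positivity
  set μ := DMPower.uniformSphere d with hμ
  set E₁ : Set (Metric.sphere (0 : DMPower.Vec d) 1) := {x | 1 / 2 < inner ℝ (v i₀) x.1 ^ 2}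
  set E₂ : Set (Metric.sphere (0 : DMPower.Vec d) 1) := {x | |inner ℝ (v i₀) x.1| < t}
  set E₃ : Set (Metric.sphere (0 : DMPower.Vec d) 1 × Metric.sphere (0 : DMPower.Vec d) 1) :=
    {x | |inner ℝ (v i₀) x.1.1 * inner ℝ (v i₁) x.2.1 -
      inner ℝ (v i₁) x.1.1 * inner ℝ (v i₀) x.2.1| <
        t * √(inner ℝ (v i₀) x.1.1 ^ 2 + inner ℝ (v i₁) x.1.1 ^ 2)}
  -- The three bad events involve neither `J` nor `K`, so outside them all admissible step counts
  -- succeed simultaneously. `E₁` accounts for `e^{-cd}`, `E₂` and `E₃` for `τ^{-c}`.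
  refine le_trans (measure_mono (t := (E₁ ×ˢ Set.univ ∪ E₂ ×ˢ Set.univ) ∪ E₃) ?_) ?_
  · intro x hx
    by_contra hgood
    simp only [Set.mem_union, Set.mem_prod, Set.mem_univ, and_true, not_or] at hgood
    refine hx fun J hJ => ?_
    exact DMPower.dmpower_of_good_start (by omega) hA h₁.symm h₂.symm hl₃ hl_d
      (h_d ▸ hlam0 _) (h₃ ▸ hl_d _) h11 h21 h32 hε hε1 hρ hρ' hτ hδ (by simp)
      (by simp) (not_lt.1 hgood.1.2) (not_lt.1 hgood.1.1) (not_lt.1 hgood.2) hJ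
  · have hE₁ : (μ.prod μ) (E₁ ×ˢ Set.univ) ≤ ENNReal.ofReal (Real.exp (-(1 / 100) * d)) := by
      rw [Measure.prod_prod, measure_univ, mul_one]
      exact DMPower.uniformSphere_cap_le hd v i₀
    have hE₂ : (μ.prod μ) (E₂ ×ˢ Set.univ) ≤ ENNReal.ofReal (4 * d * t) := by
      rw [Measure.prod_prod, measure_univ, mul_one]
      exact DMPower.uniformSphere_slab_le (v.orthonormal.1 i₀) ht0
    have hE₃ : (μ.prod μ) E₃ ≤ ENNReal.ofReal (4 * d * t) :=
      DMPower.uniformSphere_prod_minor_le v hi ht0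
    calc (μ.prod μ) ((E₁ ×ˢ Set.univ ∪ E₂ ×ˢ Set.univ) ∪ E₃) ≤
          ENNReal.ofReal (Real.exp (-(1 / 100) * d)) + ENNReal.ofReal (4 * d * t) +
            ENNReal.ofReal (4 * d * t) :=
          (measure_union_le _ _).trans
            (add_le_add ((measure_union_le _ _).trans (add_le_add hE₁ hE₂)) hE₃)
      _ = ENNReal.ofReal (Real.exp (-(1 / 100) * d) + 4 * d * t + 4 * d * t) := by
        rw [ENNReal.ofReal_add (by positivity) (by positivity),
          ENNReal.ofReal_add (by positivity) (by positivity)]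
      _ ≤ _ := by
        refine ENNReal.ofReal_le_ofReal ?_
        have := DMPower.failure_probability_le hd hτ
        rw [← ht] at this
        linarith
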